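/- Let $K$ be a field, $\overline{K}$ an algebraic closure of $K$, and $G=\mathrm{Aut}(\overline{K}/K)$ (so $G=\mathrm{Gal}(\overline K/K)$ if $K$ is perfect, and $G\cong\mathrm{Gal}(K^{\mathrm{sep}}/K)$ in general). Let $X/K$ be a complete, smooth, absolutely irreducible curve of genus at least $2$, with Jacobian $J$, so that $J(\overline{K})=\mathrm{Pic}^0(X_{\overline{K}})$ is the group of divisors of degree $0$ on $X_{\overline K}$ modulo linear equivalence, with its natural action of $G$. Let $D$ be a $K$-rational divisor of degree one, i.e. a divisor of degree one on $X_{\overline{K}}$ fixed by $G$, and let $i_D : X(\overline{K})\to J(\overline{K})$, $i_D(P)=[(P)-D]$, be the corresponding Albanese map. The curve $X$ is hyperelliptic if there is a map $f:X_{\overline K}\to\mathbb{P}^1_{\overline K}$ of degree $2$ over $\overline K$; the ramification points of such a map $f$ (which is unique up to automorphisms of $\mathbb{P}^1$) are the hyperelliptic branch points. Let $P\in X(\overline{K})$. 1. If $X$ is hyperelliptic, assume that $P$ is not a hyperelliptic branch point. If $g,h\in G$ satisfy $g\,i_D(P)+h\,i_D(P)=2\,i_D(P)$ in $J(\overline{K})$,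 then $gP=hP=P$. 2. Equivalently: either $(X,P)$ is exceptional (that is, $X$ is hyperelliptic and $P$ is a hyperelliptic branch point), or $i_D(P)$ is almost rational, i.e. for all $g,h\in G$, if $(g+h-2)\,i_D(P)=0$ in $J(\overline{K})$, then $(g-1)\,i_D(P)=(h-1)\,i_D(P)=0$. -/

import Mathlib

open CategoryTheory Limits AlgebraicGeometry

universe u

noncomputable section

namespace AlgCurve

section AlmostFixed

/-- An element `m` of a `ℤ[G]`-module is almost fixed by `G` if `(g + h - 2) m = 0` with
`g, h ∈ G` implies `(g - 1) m = (h - 1) m = 0`. -/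
def IsAlmostFixed (G : Type*) [Group G] {M : Type*} [AddCommGroup M] [DistribMulAction G M]
    (m : M) : Prop :=
  ∀ g h : G, g • m + h • m - 2 • m = 0 → g • m - m = 0 ∧ h • m - m = 0

end AlmostFixed

section Order

lemma ringOrd_equiv {R S : Type*} [CommRing R] [CommRing S] (e : R ≃+* S) (a : R) :
    Ring.ord S (e a) = Ring.ord R a := by
  let : Algebra R S := e.toRingHom.toAlgebra
  have hs : Function.Surjective (algebraMap R S) := e.surjective
  have hmap : Ideal.span {e a} = (Ideal.span {a}).map (e : R →+* S) := by
    rw [Ideal.map_span, Set.image_singleton]; rfl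
  let q : (R ⧸ Ideal.span {a}) ≃ₗ[R] (S ⧸ Ideal.span {e a}) :=
    { Ideal.quotientEquiv (Ideal.span {a}) (Ideal.span {e a}) e hmap with
      map_smul' := by
        intro r x
        obtain ⟨x, rfl⟩ := Ideal.Quotient.mk_surjective x
        change Ideal.quotientEquiv _ _ e hmap (Ideal.Quotient.mk _ (r * x)) =
          Ideal.Quotient.mk _ (e r) * Ideal.quotientEquiv _ _ e hmap (Ideal.Quotient.mk _ x)
        simp }
  rw [Ring.ord, Ring.ord, ← Module.length_eq_of_surjective (S := R) hs, q.length_eq]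

lemma ordMonoidWithZeroHom_equiv {R S : Type*} [CommRing R] [CommRing S] [IsDomain R]
    [IsDomain S] (e : R ≃+* S) (a : R) :
    Ring.ordMonoidWithZeroHom S (e a) = Ring.ordMonoidWithZeroHom R a := by
  by_cases ha : a = 0
  · simp [ha]
  · rw [Ring.ordMonoidWithZeroHom_eq_ord (mem_nonZeroDivisors_of_ne_zero ha),
      Ring.ordMonoidWithZeroHom_eq_ord (mem_nonZeroDivisors_of_ne_zero (by simpa using ha)),
      ringOrd_equiv]

/-- An isomorphism `φ : Y ⟶ Z` pulls rational functions back compatibly with orders. -/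
lemma exists_pullback_ord {Y Z : Scheme.{u}} [IsIntegral Y] [IsIntegral Z] [IsLocallyNoetherian Y]
    [IsLocallyNoetherian Z] (φ : Y ⟶ Z) [IsIso φ] (f : Z.functionField) (hf : f ≠ 0) :
    ∃ f' : Y.functionField, f' ≠ 0 ∧ ∀ y : Y, Y.ord f' y = Z.ord f (φ y) := by
  have hgen : φ (genericPoint Y) = genericPoint Z := genericPoint_eq_of_isOpenImmersion φ
  have hsp : φ (genericPoint Y) ⤳ genericPoint Z := by rw [hgen]
  let Φ : Z.functionField →+* Y.functionField :=
    (Z.presheaf.stalkSpecializes hsp ≫ φ.stalkMap (genericPoint Y)).hom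
  have hΦ (y : Y) (a : Z.presheaf.stalk (φ y)) :
      Φ (algebraMap _ Z.functionField a) =
        algebraMap _ Y.functionField ((φ.stalkMap y).hom a) := by
    have hy : genericPoint Y ⤳ y := (genericPoint_spec Y).specializes trivial
    have h1 := φ.stalkSpecializes_stalkMap (genericPoint Y) y hy
    have h2 : Z.presheaf.stalkSpecializes ((genericPoint_spec Z).specializes trivial) ≫
        Z.presheaf.stalkSpecializes hsp =
        Z.presheaf.stalkSpecializes (hy.map φ.continuous) := by
      rw [TopCat.Presheaf.stalkSpecializes_comp]
    have h3 : Z.presheaf.stalkSpecializes ((genericPoint_spec Z).specializes trivial) ≫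
        Z.presheaf.stalkSpecializes hsp ≫ φ.stalkMap (genericPoint Y) =
        φ.stalkMap y ≫ Y.presheaf.stalkSpecializes hy := by
      rw [reassoc_of% h2]
      exact h1
    exact congr($(h3).hom a)
  refine ⟨Φ f, by simpa using hf, fun y => ?_⟩
  have hco : Order.coheight (φ y) = Order.coheight y := coheight_eq_of_isOpenImmersion φ
  by_cases hy : Order.coheight y = 1
  swap
  · rw [Scheme.ord_eq_zero_of_coheight_neq_one hy,
      Scheme.ord_eq_zero_of_coheight_neq_one (by rwa [hco])]
  have hy' : Order.coheight (φ y) = 1 := hco.trans hy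
  have : Ring.KrullDimLE 1 (Y.presheaf.stalk y) := krullDimLE_of_coheight_le hy.le
  have : Ring.KrullDimLE 1 (Z.presheaf.stalk (φ y)) := krullDimLE_of_coheight_le hy'.le
  have key : Y.ordHom y hy (Φ f) = Z.ordHom (φ y) hy' f := by
    obtain ⟨a, b, hb, rfl⟩ := IsFractionRing.div_surjective (A := Z.presheaf.stalk (φ y)) f
    let e : Z.presheaf.stalk (φ y) ≃+* Y.presheaf.stalk y :=
      (asIso (φ.stalkMap y)).commRingCatIsoToRingEquiv
    have he (c : Z.presheaf.stalk (φ y)) : Y.ordHom y hy (Φ (algebraMap _ _ c)) =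
        Z.ordHom (φ y) hy' (algebraMap _ _ c) := by
      by_cases hc : c = 0
      · simp [hc]
      rw [hΦ, Scheme.ordHom, Scheme.ordHom, Ring.ordFrac_eq_ord _ hc, Ring.ordFrac_eq_ord]
      · exact ordMonoidWithZeroHom_equiv e c
      · have : e c ≠ 0 := by simpa using hc
        exact this
    rw [map_div₀, map_div₀, map_div₀, he, he]
  rw [Scheme.ord_eq_ordHom_of_coheight_eq_one hy, Scheme.ord_eq_ordHom_of_coheight_eq_one hy', key]

end Order

section Curves

attribute [local instance] MvPolynomial.gradedAlgebra

/-- A curve over a field `k`: a complete, nonsingular (i.e. smooth over `k`), absolutely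
irreducible variety of dimension one over `k`, given by its structure morphism. -/
class IsCurve {k : Type u} [Field k] {C : Scheme.{u}} (t : C ⟶ Spec (.of k)) : Prop extends
  IsProper t, SmoothOfRelativeDimension 1 t, GeometricallyIntegral t

/-- The `k`-algebra structure on the function field of an integral `k`-scheme. -/
@[reducible]
def functionFieldAlgebra {k : Type u} [Field k] {C : Scheme.{u}} [IsIntegral C]
    (t : C ⟶ Spec (.of k)) : Algebra k C.functionField :=
  ((Scheme.ΓSpecIso (.of k)).inv ≫ t.appTop ≫
    C.presheaf.germ ⊤ (genericPoint C) trivial).hom.toAlgebra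

/-- The space of global regular differentials `H⁰(C, Ω)` of a smooth integral `k`-scheme `C`: the
differentials of the function field `k(C)` over `k` that are regular at every point `x`, i.e. are
sums of differentials `b da` with `a, b` in the local ring at `x`. -/
def regularDifferentials {k : Type u} [Field k] {C : Scheme.{u}} [IsIntegral C]
    (t : C ⟶ Spec (.of k)) :
    letI := functionFieldAlgebra t
    Submodule k (KaehlerDifferential k C.functionField) :=
  letI := functionFieldAlgebra t
  ⨅ x : C, Submodule.span k
    {ω | ∃ a b : C.presheaf.stalk x, ω = algebraMap (C.presheaf.stalk x) C.functionField b •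
      KaehlerDifferential.D k C.functionField (algebraMap (C.presheaf.stalk x) C.functionField a)}

/-- The genus of a complete smooth curve over an algebraically closed field `k`: the dimension over
`k` of the space of global regular differentials. -/
def genus {k : Type u} [Field k] {C : Scheme.{u}} [IsIntegral C] (t : C ⟶ Spec (.of k)) : ℕ :=
  letI := functionFieldAlgebra t
  Module.finrank k (regularDifferentials t)

/-- The projective line over `k`. -/
def P1 (k : Type u) [Field k] : Scheme.{u} :=
  Proj (MvPolynomial.homogeneousSubmodule (Fin 2) k)

/-- The structure morphism of the projective line. -/
def P1.toSpec (k : Type u) [Field k] : P1 k ⟶ Spec (.of k) :=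
  Proj.toSpecZero (MvPolynomial.homogeneousSubmodule (Fin 2) k) ≫
    Spec.map (CommRingCat.ofHom
      (algebraMap k (MvPolynomial.homogeneousSubmodule (Fin 2) k 0)))

/-- The degree of a dominant morphism `f : C ⟶ Y` of integral schemes: the degree of the extension
of function fields. As `f` maps the generic point of `C` to the generic point of `Y`, the ring
`O_{Y, f(η)}` is the function field of `Y`. -/
def mapDegree {C Y : Scheme.{u}} [IsIntegral C] (f : C ⟶ Y) : ℕ :=
  letI : Algebra (Y.presheaf.stalk (f (genericPoint C))) C.functionField :=
    (f.stalkMap (genericPoint C)).hom.toAlgebra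
  Module.finrank (Y.presheaf.stalk (f (genericPoint C))) C.functionField

/-- `f : C ⟶ ℙ¹` is a map over `k` of degree two. -/
def IsDegreeTwoMap {k : Type u} [Field k] {C : Scheme.{u}} [IsIntegral C]
    (t : C ⟶ Spec (.of k)) (f : C ⟶ P1 k) : Prop :=
  f ≫ P1.toSpec k = t ∧ IsDominant f ∧ mapDegree f = 2

/-- `f` is ramified at the closed point `x` of a curve over an algebraically closed field:
`𝔪_{f(x)} O_x` is not the maximal ideal of `O_x`, i.e. the ramification index is not one. -/
def IsRamifiedAt {C Y : Scheme.{u}} (f : C ⟶ Y) (x : C) : Prop :=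
  (IsLocalRing.maximalIdeal (Y.presheaf.stalk (f x))).map (f.stalkMap x).hom ≠
    IsLocalRing.maximalIdeal (C.presheaf.stalk x)

end Curves

section GaloisAction

variable {K : Type u} [Field K] {X : Scheme.{u}} (s : X ⟶ Spec (.of K))
  (L : Type u) [Field L] [Algebra K L]

/-- The morphism `Spec L ⟶ Spec K`. -/
abbrev specMap (K L : Type u) [Field K] [Field L] [Algebra K L] :
    Spec (.of L) ⟶ Spec (.of K) :=
  Spec.map (CommRingCat.ofHom (algebraMap K L))

/-- The base change `X_L` of `X` to `L`. -/
abbrev baseChange : Scheme.{u} := pullback s (specMap K L)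

/-- The structure morphism `X_L ⟶ Spec L`. -/
abbrev baseChangeHom : baseChange s L ⟶ Spec (.of L) := pullback.snd s (specMap K L)

/-- The set `X(L)` of `L`-valued points of the `K`-scheme `X`. -/
@[ext]
structure Pt where
  /-- The underlying morphism. -/
  hom : Spec (.of L) ⟶ X
  /-- It is a morphism over `K`. -/
  w : hom ≫ s = specMap K L

variable {s L}

lemma specMap_aut (σ : L ≃ₐ[K] L) :
    Spec.map (CommRingCat.ofHom (σ : L →+* L)) ≫ specMap K L = specMap K L := by
  rw [← Spec.map_comp, ← CommRingCat.ofHom_comp]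
  congr 2
  ext x
  exact σ.commutes x

/-- `Aut(L/K)` acts on `X(L)`; in affine coordinates it acts on each coordinate. -/
instance : MulAction (L ≃ₐ[K] L) (Pt s L) where
  smul σ p := ⟨Spec.map (CommRingCat.ofHom (σ : L →+* L)) ≫ p.hom, by
    rw [Category.assoc, p.w, specMap_aut]⟩
  one_smul p := Pt.ext (by
    change Spec.map (𝟙 (CommRingCat.of L)) ≫ p.hom = p.hom
    simp)
  mul_smul σ τ p := Pt.ext (by
    change Spec.map (CommRingCat.ofHom (τ : L →+* L) ≫ CommRingCat.ofHom (σ : L →+* L)) ≫ p.hom =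
      Spec.map (CommRingCat.ofHom (σ : L →+* L)) ≫
        Spec.map (CommRingCat.ofHom (τ : L →+* L)) ≫ p.hom
    rw [Spec.map_comp, Category.assoc])

lemma Pt.smul_hom (σ : L ≃ₐ[K] L) (p : Pt s L) :
    (σ • p).hom = Spec.map (CommRingCat.ofHom (σ : L →+* L)) ≫ p.hom := rfl

/-- The section `Spec L ⟶ X_L` given by an `L`-valued point. -/
def Pt.section (p : Pt s L) : Spec (.of L) ⟶ baseChange s L :=
  pullback.lift p.hom (𝟙 _) (by rw [p.w, Category.id_comp])

/-- The point of `X_L` given by an `L`-valued point of `X`. If `L` is algebraically closed, this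
identifies `X(L)` with the closed points of `X_L`. -/
def Pt.point (p : Pt s L) : baseChange s L :=
  p.section (IsLocalRing.closedPoint L)

/-- The automorphism `id × Spec σ` of the scheme `X_L`. -/
def galMap (s : X ⟶ Spec (.of K)) (σ : L ≃ₐ[K] L) : baseChange s L ⟶ baseChange s L :=
  pullback.lift (pullback.fst _ _)
    (pullback.snd _ _ ≫ Spec.map (CommRingCat.ofHom (σ : L →+* L)))
    (by rw [Category.assoc, specMap_aut, pullback.condition])

lemma galMap_fst (σ : L ≃ₐ[K] L) :
    galMap s σ ≫ pullback.fst s (specMap K L) = pullback.fst s (specMap K L) :=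
  pullback.lift_fst _ _ _

lemma galMap_snd (σ : L ≃ₐ[K] L) :
    galMap s σ ≫ pullback.snd s (specMap K L) =
      pullback.snd s (specMap K L) ≫ Spec.map (CommRingCat.ofHom (σ : L →+* L)) :=
  pullback.lift_snd _ _ _

lemma Pt.section_fst (p : Pt s L) : p.section ≫ pullback.fst s (specMap K L) = p.hom :=
  pullback.lift_fst _ _ _

lemma Pt.section_snd (p : Pt s L) : p.section ≫ pullback.snd s (specMap K L) = 𝟙 _ :=
  pullback.lift_snd _ _ _

lemma Spec_aut_mul (σ τ : L ≃ₐ[K] L) (h : σ * τ = 1) :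
    Spec.map (CommRingCat.ofHom (σ : L →+* L)) ≫
      Spec.map (CommRingCat.ofHom (τ : L →+* L)) = 𝟙 _ := by
  rw [← Spec.map_comp, ← CommRingCat.ofHom_comp, ← Spec.map_id, ← CommRingCat.ofHom_id]
  congr 2
  ext x
  exact congr($h x)

lemma galMap_comp (σ τ : L ≃ₐ[K] L) (h : σ * τ = 1) : galMap s σ ≫ galMap s τ = 𝟙 _ := by
  apply pullback.hom_ext
  · rw [Category.assoc, galMap_fst, galMap_fst, Category.id_comp]
  · rw [Category.assoc, galMap_snd, ← Category.assoc, galMap_snd, Category.assoc,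
      Spec_aut_mul σ τ h, Category.id_comp, Category.comp_id]

instance (σ : L ≃ₐ[K] L) : IsIso (galMap s σ) :=
  ⟨galMap s σ⁻¹, galMap_comp _ _ (by simp), galMap_comp _ _ (by simp)⟩

lemma Pt.smul_point (σ : L ≃ₐ[K] L) (p : Pt s L) :
    (σ⁻¹ • p).point = galMap s σ p.point := by
  have h : Spec.map (CommRingCat.ofHom ((σ⁻¹ : L ≃ₐ[K] L) : L →+* L)) ≫ p.section ≫ galMap s σ =
      (σ⁻¹ • p).section := by
    apply pullback.hom_ext
    · rw [Category.assoc, Category.assoc, galMap_fst, Pt.section_fst, Pt.section_fst, Pt.smul_hom]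
    · rw [Category.assoc, Category.assoc, galMap_snd, ← Category.assoc p.section, Pt.section_snd,
        Pt.section_snd, Category.id_comp, Spec_aut_mul σ⁻¹ σ (by simp)]
  have hc : Spec.map (CommRingCat.ofHom ((σ⁻¹ : L ≃ₐ[K] L) : L →+* L))
      (IsLocalRing.closedPoint L) = IsLocalRing.closedPoint L := Subsingleton.elim _ _
  rw [Pt.point, ← h]
  exact congrArg (fun z => galMap s σ (p.section z)) hc

variable (s L)

/-- Divisors on `X_L`, for `L` algebraically closed: the free abelian group on `X(L)`. -/
abbrev Div : Type u := Pt s L →₀ ℤ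

/-- `Aut(L/K)` acts on divisors by permuting the points. -/
instance : DistribMulAction (L ≃ₐ[K] L) (Div s L) := Finsupp.comapDistribMulAction

lemma Div.smul_apply (σ : L ≃ₐ[K] L) (D : Div s L) (p : Pt s L) : (σ • D) p = D (σ⁻¹ • p) :=
  Finsupp.comapSMul_apply σ D p

lemma Div.degree_smul (σ : L ≃ₐ[K] L) (D : Div s L) : (σ • D).degree = D.degree :=
  Finsupp.degree_mapDomain _ _

/-- A divisor on `X_L` is `K`-rational if it is fixed by `Aut(L/K)`. -/
def Div.IsRational (D : Div s L) : Prop := ∀ σ : L ≃ₐ[K] L, σ • D = D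

/-- The group of divisors of degree zero on `X_L`. -/
abbrev Div0 : AddSubgroup (Div s L) := (Finsupp.degree : Div s L →+ ℤ).ker

instance : DistribMulAction (L ≃ₐ[K] L) (Div0 s L) where
  smul σ D := ⟨σ • D.1, by
    rw [AddMonoidHom.mem_ker, Div.degree_smul]; exact D.2⟩
  one_smul D := Subtype.ext (one_smul _ D.1)
  mul_smul σ τ D := Subtype.ext (mul_smul σ τ D.1)
  smul_zero σ := Subtype.ext (smul_zero σ)
  smul_add σ D E := Subtype.ext (smul_add σ D.1 E.1)

variable [IsCurve s]

instance : IsLocallyNoetherian (baseChange s L) :=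
  LocallyOfFiniteType.isLocallyNoetherian (baseChangeHom s L)

instance : Smooth s := SmoothOfRelativeDimension.smooth 1 s

instance : IsIntegral (baseChange s L) := inferInstance

/-- The group of principal divisors on `X_L`: the divisors `div f = ∑ ord_p(f) p` of the nonzero
rational functions `f` on `X_L`. -/
def principal : AddSubgroup (Div s L) where
  carrier := {D | ∃ f : (baseChange s L).functionField, f ≠ 0 ∧
    ∀ p : Pt s L, D p = (baseChange s L).ord f p.point}
  zero_mem' := ⟨1, one_ne_zero, fun p => by
    have := Scheme.ord_mul (x := p.point)
      (one_ne_zero (α := (baseChange s L).functionField)) one_ne_zero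
    rw [mul_one] at this
    rw [Finsupp.zero_apply]
    omega⟩
  add_mem' := by
    rintro D E ⟨f, hf, hD⟩ ⟨g, hg, hE⟩
    exact ⟨f * g, mul_ne_zero hf hg, fun p => by
      rw [Finsupp.add_apply, hD, hE, Scheme.ord_mul hf hg]⟩
  neg_mem' := by
    rintro D ⟨f, hf, hD⟩
    refine ⟨f⁻¹, inv_ne_zero hf, fun p => ?_⟩
    have h1 := Scheme.ord_mul (x := p.point)
      (one_ne_zero (α := (baseChange s L).functionField)) one_ne_zero
    have h2 := Scheme.ord_mul (x := p.point) hf (inv_ne_zero hf)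
    rw [mul_one] at h1
    rw [mul_inv_cancel₀ hf] at h2
    rw [Finsupp.neg_apply, hD]
    omega

lemma smul_mem_principal (σ : L ≃ₐ[K] L) {D : Div s L} (hD : D ∈ principal s L) :
    σ • D ∈ principal s L := by
  obtain ⟨f, hf, hD⟩ := hD
  obtain ⟨f', hf', h⟩ := exists_pullback_ord (galMap s σ) f hf
  exact ⟨f', hf', fun p => by rw [h, Div.smul_apply, hD, Pt.smul_point]⟩

/-- The group `J(L) = Pic⁰(X_L)` of `L`-valued points of the Jacobian `J` of `X`, for `L`
algebraically closed: divisors of degree zero on `X_L` modulo linear equivalence. -/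
abbrev Jac : Type u := Div0 s L ⧸ (principal s L).addSubgroupOf (Div0 s L)

/-- `Aut(L/K)` acts on `J(L)` through its action on divisors. -/
instance : DistribMulAction (L ≃ₐ[K] L) (Jac s L) where
  smul σ := QuotientAddGroup.map _ _ (DistribSMul.toAddMonoidHom (Div0 s L) σ)
    (fun _ hD => smul_mem_principal s L σ hD)
  one_smul x := by
    induction x using QuotientAddGroup.induction_on with
    | H D => exact congrArg _ (one_smul (L ≃ₐ[K] L) D)
  mul_smul σ τ x := by
    induction x using QuotientAddGroup.induction_on with
    | H D => exact congrArg _ (mul_smul σ τ D)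
  smul_zero σ := map_zero (QuotientAddGroup.map _ _ _ _)
  smul_add σ x y := map_add (QuotientAddGroup.map _ _ _ _) x y

variable {s L}

/-- The Albanese map `i_D : X(L) → J(L)`, `P ↦ [(P) - D]`, of a divisor `D` of degree one. -/
def albanese (D : Div s L) (hD : D.degree = 1) (P : Pt s L) : Jac s L :=
  QuotientAddGroup.mk ⟨Finsupp.single P 1 - D, by
    rw [AddMonoidHom.mem_ker, map_sub, Finsupp.degree_single, hD, sub_self]⟩

variable (s L)

/-- `X` is hyperelliptic: there is a map `X_L ⟶ ℙ¹` over `L` of degree two (where `L` is an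
algebraic closure of `K`, and `X` has genus at least two). -/
def IsHyperelliptic : Prop :=
  ∃ f : baseChange s L ⟶ P1 L, IsDegreeTwoMap (baseChangeHom s L) f

variable {s L}

/-- `P` is a hyperelliptic branch point: a ramification point of a degree two map to `ℙ¹` (which is
unique up to automorphisms of `ℙ¹` if the genus is at least two). -/
def IsHyperellipticBranchPoint (P : Pt s L) : Prop :=
  ∃ f : baseChange s L ⟶ P1 L, IsDegreeTwoMap (baseChangeHom s L) f ∧ IsRamifiedAt f P.point

/-- The pair `(X, P)` is exceptional: `X` is hyperelliptic and `P` is a hyperelliptic branch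
point. -/
def IsExceptional (P : Pt s L) : Prop :=
  IsHyperelliptic s L ∧ IsHyperellipticBranchPoint P

end GaloisAction

end AlgCurve

end

/-!
A relation `g i_D(P) + h i_D(P) = 2 i_D(P)` with `D` rational says that the divisor
`gP + hP - 2P` is the divisor of a rational function `f` on `Y = X_L`. If `gP = P` or `hP = P`, then
`f` has at most one pole, and that one simple. So either `f` has no pole, and the remaining points
agree as well, or `L(f)` is the whole function field, and `Y` has genus zero. If both points differ
from `P`, then `f` has a double pole at `P` as its only pole. So `f` has degree at most two, and
exactly two because the genus is not zero, and it is a map of degree two to the projective line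
ramified at `P`: the pair `(X, P)` is exceptional (`eq_and_eq_of_mem_principal`).

Three facts carry the argument.

* The degree of the function field over `L(f)` is at most the number of poles of `f`, counted with
  multiplicity (`IsOrderFamily.card_le_of_polynomial_independent`). The proof is the easy half of
  the theorem of Riemann–Roch, the inequality `dim L(D) ≤ deg D + 1`, applied to large multiples of
  the pole divisor. It uses only a few properties of the orders at closed points, collected in
  `IsOrderFamily`; they hold on a complete smooth curve (`isOrderFamily`), where the local rings are
  discrete valuation rings because their cotangent spaces are quotients of their modules of
  differentials (`isDiscreteValuationRing_stalk`).

* If the function field is `L(f)`, then there are no regular differentials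
  (`regularDifferentials_eq_bot`): the coefficient of `df` in a regular differential has no
  poles, and it vanishes at the poles of `f`.

* A nonconstant function `f` defines a morphism to the projective line (`exists_hom_P1`). At every
  point `x` one of `f` and `f⁻¹` is in the local ring and gives a morphism `Spec 𝒪_x → ℙ¹`; these
  agree at the generic point, so they spread out and glue (`exists_hom_of_fromSpecStalk`). The
  description of the induced maps on local rings by homogeneous coordinates
  (`exists_chartHom_eq_of_fromSpecStalk`) then gives dominance, the degree and the ramification.
-/

noncomputable section

namespace AlgCurve

/-! ### Pole degrees bound degrees of function fields -/

section PoleDegree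

open Polynomial

/-- A field `F` over `k` with a family of discrete valuations `ord x`, each having residue field
`k`, such that every element has finitely many poles and elements without poles are constant. The
function field of a complete nonsingular curve over an algebraically closed field is an example.
The orders are `ℤ`-valued, and nothing is required of their values at `0`. -/
structure IsOrderFamily (k : Type*) {F S : Type*} [Field k] [Field F] [Algebra k F]
    (ord : S → F → ℤ) : Prop where
  map_mul : ∀ x {a b : F}, a ≠ 0 → b ≠ 0 → ord x (a * b) = ord x a + ord x b
  le_add : ∀ x {a b : F}, a + b ≠ 0 → a ≠ 0 → b ≠ 0 → min (ord x a) (ord x b) ≤ ord x (a + b)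
  map_const : ∀ x {c : k}, c ≠ 0 → ord x (algebraMap k F c) = 0
  exists_lt : ∀ x {a b : F}, a ≠ 0 → b ≠ 0 → ord x a = ord x b →
    ∃ c : k, a - c • b = 0 ∨ ord x a < ord x (a - c • b)
  finite_poles : ∀ {a : F}, a ≠ 0 → {x | ord x a < 0}.Finite
  exists_eq_const : ∀ {a : F}, a ≠ 0 → (∀ x, 0 ≤ ord x a) → ∃ c : k, algebraMap k F c = a

variable {k F S : Type*} [Field k] [Field F] [Algebra k F] {ord : S → F → ℤ}

namespace IsOrderFamily

open Classical in
/-- The Riemann–Roch space `L(D)` of an effective divisor, given as a multiset of points. -/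
def rrSpace (h : IsOrderFamily k ord) (D : Multiset S) : Submodule k F where
  carrier := {a | a ≠ 0 → ∀ x, -(D.count x : ℤ) ≤ ord x a}
  zero_mem' h0 := absurd rfl h0
  add_mem' {a b} ha hb hab x := by
    by_cases ha0 : a = 0
    · subst ha0; rw [zero_add] at hab ⊢; exact hb hab x
    by_cases hb0 : b = 0
    · subst hb0; rw [add_zero] at hab ⊢; exact ha hab x
    exact (le_min (ha ha0 x) (hb hb0 x)).trans (h.le_add x hab ha0 hb0)
  smul_mem' c a ha hca x := by
    have hc : c ≠ 0 := fun h0 => hca (by rw [h0, zero_smul])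
    have ha0 : a ≠ 0 := fun h0 => hca (by rw [h0, smul_zero])
    rw [Algebra.smul_def, h.map_mul x (by simpa using hc) ha0, h.map_const x hc, zero_add]
    exact ha ha0 x

variable (h : IsOrderFamily k ord)
include h

open Classical in
lemma mem_rrSpace {D : Multiset S} {a : F} :
    a ∈ h.rrSpace D ↔ (a ≠ 0 → ∀ x, -(D.count x : ℤ) ≤ ord x a) := Iff.rfl

lemma rrSpace_mono {D E : Multiset S} (hDE : D ≤ E) : h.rrSpace D ≤ h.rrSpace E := by
  classical
  intro a ha ha0 x
  have := Multiset.count_le_of_le x hDE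
  have := ha ha0 x
  omega

lemma mul_mem_rrSpace {D E : Multiset S} {a b : F} (ha : a ∈ h.rrSpace D) (hb : b ∈ h.rrSpace E) :
    a * b ∈ h.rrSpace (D + E) := by
  classical
  intro hab x
  have ha0 := left_ne_zero_of_mul hab
  have hb0 := right_ne_zero_of_mul hab
  have h1 := ha ha0 x
  have h2 := hb hb0 x
  rw [h.map_mul x ha0 hb0, Multiset.count_add]
  push_cast
  omega

lemma one_mem_rrSpace (D : Multiset S) : (1 : F) ∈ h.rrSpace D := by
  intro _ x
  have := h.map_const x (one_ne_zero (α := k))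
  rw [map_one] at this
  omega

lemma pow_mem_rrSpace {D : Multiset S} {a : F} (ha : a ∈ h.rrSpace D) (n : ℕ) :
    a ^ n ∈ h.rrSpace (n • D) := by
  induction n with
  | zero => rw [pow_zero]; exact h.one_mem_rrSpace _
  | succ n ih => rw [pow_succ, succ_nsmul]; exact h.mul_mem_rrSpace ih ha

/-- The inequality `dim L(D) ≤ deg D + 1`: allowing one more pole at `x` adds at most the one
leading coefficient at `x`. -/
lemma finrank_rrSpace_le (D : Multiset S) :
    Module.Finite k (h.rrSpace D) ∧ Module.finrank k (h.rrSpace D) ≤ D.card + 1 := by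
  classical
  -- it is enough to have a spanning set of the right size
  suffices H : ∃ T : Finset F, T.card ≤ D.card + 1 ∧ h.rrSpace D ≤ Submodule.span k T by
    obtain ⟨T, hT, hle⟩ := H
    have hfin : Module.Finite k (Submodule.span k (T : Set F)) :=
      Module.Finite.span_of_finite k T.finite_toSet
    exact ⟨Submodule.finiteDimensional_of_le hle,
      (Submodule.finrank_mono hle).trans ((finrank_span_finset_le_card T).trans hT)⟩
  induction D using Multiset.induction with
  | empty =>
    refine ⟨{1}, by simp, fun a ha => ?_⟩
    by_cases ha0 : a = 0
    · rw [ha0]; exact zero_mem _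
    obtain ⟨c, rfl⟩ := h.exists_eq_const ha0 (fun x => by simpa using ha ha0 x)
    rw [Algebra.algebraMap_eq_smul_one]
    exact Submodule.smul_mem _ _ (Submodule.subset_span (by simp))
  | cons x D ih =>
    obtain ⟨T, hT, hle⟩ := ih
    by_cases hex : ∃ b ∈ h.rrSpace (x ::ₘ D), b ∉ h.rrSpace D
    swap
    · push Not at hex
      exact ⟨T, by rw [Multiset.card_cons]; omega, fun a ha => hle (hex a ha)⟩
    -- an element of `L(D + x)` outside `L(D)` has order exactly `-(D x) - 1` at `x`
    have key : ∀ b ∈ h.rrSpace (x ::ₘ D), b ∉ h.rrSpace D →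
        b ≠ 0 ∧ ord x b = -(D.count x : ℤ) - 1 := by
      intro b hb hbD
      rw [mem_rrSpace] at hbD
      push Not at hbD
      obtain ⟨hb0, y, hy⟩ := hbD
      have h1 := hb hb0 y
      rw [Multiset.count_cons] at h1
      split_ifs at h1 with hyx
      · subst hyx
        exact ⟨hb0, by push_cast at h1; omega⟩
      · push_cast at h1; omega
    obtain ⟨b, hb, hbD⟩ := hex
    obtain ⟨hb0, hbx⟩ := key b hb hbD
    refine ⟨insert b T, (Finset.card_insert_le _ _).trans (by rw [Multiset.card_cons]; omega),
      fun a ha => ?_⟩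
    rw [Finset.coe_insert, Submodule.span_insert, Submodule.mem_sup]
    by_cases haD : a ∈ h.rrSpace D
    · exact ⟨0, zero_mem _, a, hle haD, zero_add _⟩
    obtain ⟨ha0, hax⟩ := key a ha haD
    obtain ⟨c, hc⟩ := h.exists_lt x ha0 hb0 (hax.trans hbx.symm)
    refine ⟨c • b, Submodule.smul_mem _ _ (Submodule.mem_span_singleton_self b), a - c • b,
      hle ?_, by abel⟩
    intro hne y
    by_cases hyx : y = x
    · subst hyx
      rcases hc with hc | hc
      · exact absurd hc hne
      · omega
    · have := (sub_mem ha (Submodule.smul_mem _ c hb) : a - c • b ∈ h.rrSpace (x ::ₘ D)) hne y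
      rwa [Multiset.count_cons_of_ne hyx] at this

lemma exists_mem_rrSpace (a : F) : ∃ C : Multiset S, a ∈ h.rrSpace C := by
  classical
  by_cases ha : a = 0
  · exact ⟨0, by rw [ha]; exact zero_mem _⟩
  let T := (h.finite_poles ha).toFinset
  refine ⟨∑ x ∈ T, Multiset.replicate (-ord x a).toNat x, fun _ x => ?_⟩
  by_cases hx : 0 ≤ ord x a
  · omega
  have hxT : x ∈ T := by simpa [T] using hx
  have h1 := Multiset.count_le_of_le x
    (Finset.single_le_sum (f := fun x => Multiset.replicate (-ord x a).toNat x)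
      (fun _ _ => Multiset.zero_le _) hxT)
  rw [Multiset.count_replicate_self] at h1
  omega

/-- If the pole divisor of `f` is at most `B`, then a family linearly independent over `k[f]` has
at most `deg B` members; so `[F : k(f)] ≤ deg B` if `f` is not constant. This compares, as `l`
grows, the number of products `f ^ j * u i` with `j ≤ l` to the dimension of the Riemann–Roch
space `L(l B + C)` that contains them. -/
theorem card_le_of_polynomial_independent {f : F} {B : Multiset S} (hf : f ∈ h.rrSpace B)
    {κ : Type*} [Fintype κ] (u : κ → F)
    (hu : ∀ p : κ → k[X], ∑ i, aeval f (p i) * u i = 0 → p = 0) :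
    Fintype.card κ ≤ B.card := by
  classical
  choose C hC using fun i => h.exists_mem_rrSpace (u i)
  let E : Multiset S := ∑ i, C i
  have hE (i) : u i ∈ h.rrSpace E :=
    h.rrSpace_mono (Finset.single_le_sum (fun _ _ => Multiset.zero_le _) (Finset.mem_univ i)) (hC i)
  have bound (l : ℕ) : Fintype.card κ * (l + 1) ≤ l * B.card + E.card + 1 := by
    have hmem (q : κ × Fin (l + 1)) : f ^ (q.2 : ℕ) * u q.1 ∈ h.rrSpace (l • B + E) :=
      h.rrSpace_mono (by gcongr; omega) (h.mul_mem_rrSpace (h.pow_mem_rrSpace hf q.2) (hE q.1))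
    have hli : LinearIndependent k
        (fun q : κ × Fin (l + 1) => (⟨_, hmem q⟩ : h.rrSpace (l • B + E))) := by
      rw [Fintype.linearIndependent_iff]
      intro c hc
      have hp := hu (fun i => ∑ j : Fin (l + 1), Polynomial.C (c (i, j)) * X ^ (j : ℕ)) (by
        have := congrArg Subtype.val hc
        simp only [AddSubmonoidClass.coe_finsetSum, Submodule.coe_smul, ZeroMemClass.coe_zero,
          Fintype.sum_prod_type] at this
        rw [← this]
        refine Finset.sum_congr rfl fun i _ => ?_
        rw [map_sum, Finset.sum_mul]
        refine Finset.sum_congr rfl fun j _ => ?_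
        simp [Algebra.smul_def, mul_assoc])
      rintro ⟨i, j⟩
      have := congrArg (fun p => (p i).coeff j) hp
      simpa [finsetSum_coeff, coeff_C_mul, coeff_X_pow, Fin.val_inj] using this
    obtain ⟨hfin, hle⟩ := h.finrank_rrSpace_le (l • B + E)
    have := hli.fintype_card_le_finrank
    simp only [Fintype.card_prod, Fintype.card_fin] at this
    rw [Multiset.card_add, Multiset.card_nsmul] at hle
    omega
  by_contra! hlt
  have h1 := bound (E.card + 1)
  have h2 : (B.card + 1) * (E.card + 1 + 1) ≤ Fintype.card κ * (E.card + 1 + 1) :=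
    Nat.mul_le_mul_right _ hlt
  nlinarith

end IsOrderFamily

end PoleDegree

/-! ### Regular differentials on a rational curve -/

section RationalDifferentials

open Polynomial KaehlerDifferential IntermediateField

lemma adjoin_inv_eq_top {k F : Type*} [Field k] [Field F] [Algebra k F] {f : F}
    (h : k⟮f⟯ = ⊤) : k⟮f⁻¹⟯ = ⊤ := by
  rw [eq_top_iff, ← h, adjoin_simple_le_iff, ← inv_inv f]
  exact inv_mem (by simpa using mem_adjoin_simple_self k f⁻¹)

/-- The differential of an element of a local ring containing `f`, when `F = k(f)`: writing `b` as
a fraction in lowest terms, the denominator must be a unit of the local ring, so `db` is a multiple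
of `df` by an element of the local ring. -/
lemma exists_D_eq_smul {k R F : Type*} [Field k] [CommRing R] [IsLocalRing R] [Field F]
    [Algebra k R] [Algebra R F] [Algebra k F] [IsScalarTower k R F] [FaithfulSMul R F] {f : R}
    (hf : k⟮algebraMap R F f⟯ = ⊤) (b : R) :
    ∃ u : R, D k F (algebraMap R F b) = algebraMap R F u • D k F (algebraMap R F f) := by
  classical
  have hinj := FaithfulSMul.algebraMap_injective R F
  obtain ⟨p, q, hpq⟩ := (mem_adjoin_simple_iff k (algebraMap R F b)).1 (by rw [hf]; trivial)
  by_cases hq : aeval (algebraMap R F f) q = 0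
  · rw [hq, div_zero] at hpq
    exact ⟨0, by rw [hpq]; simp⟩
  have hq0 : q ≠ 0 := fun h0 => hq (by rw [h0, map_zero])
  obtain ⟨p', hp'⟩ := EuclideanDomain.gcd_dvd_left p q
  obtain ⟨q', hq'⟩ := EuclideanDomain.gcd_dvd_right p q
  set g := EuclideanDomain.gcd p q
  have hg : g ≠ 0 := fun h0 => hq0 (by rw [hq', h0, zero_mul])
  have hcop : ∃ s t, s * p' + t * q' = 1 := by
    refine ⟨EuclideanDomain.gcdA p q, EuclideanDomain.gcdB p q, mul_left_cancel₀ hg ?_⟩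
    calc _ = (g * p') * EuclideanDomain.gcdA p q + (g * q') * EuclideanDomain.gcdB p q := by ring
      _ = g * 1 := by rw [← hp', ← hq', mul_one, ← EuclideanDomain.gcd_eq_gcd_ab]
  obtain ⟨s, t, hst⟩ := hcop
  have heq : b * aeval f q' = aeval f p' := by
    apply hinj
    rw [map_mul, ← aeval_algebraMap_apply, ← aeval_algebraMap_apply]
    rw [hq', map_mul] at hq
    rw [hpq, hp', hq', map_mul, map_mul]
    have h1 := left_ne_zero_of_mul hq
    have h2 := right_ne_zero_of_mul hq
    rw [mul_div_mul_left _ _ h1, div_mul_cancel₀ _ h2]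
  have hunit : IsUnit (aeval f q') := by
    by_contra hn
    have hm : aeval f q' ∈ IsLocalRing.maximalIdeal R := hn
    refine (IsLocalRing.maximalIdeal.isMaximal R).ne_top ((Ideal.eq_top_iff_one _).2 ?_)
    rw [← map_one (aeval (R := k) f), ← hst, map_add, map_mul, map_mul, ← heq]
    exact add_mem (Ideal.mul_mem_left _ _ (Ideal.mul_mem_left _ _ hm)) (Ideal.mul_mem_left _ _ hm)
  obtain ⟨v, hv⟩ := hunit.exists_left_inv
  refine ⟨v * (aeval f (derivative p') - b * aeval f (derivative q')), ?_⟩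
  have h1 := congrArg (fun x => D k F (algebraMap R F x)) heq
  simp only [map_mul, ← aeval_algebraMap_apply, Derivation.leibniz, Derivation.map_aeval] at h1
  have hv' := congrArg (algebraMap R F) hv
  simp only [map_mul, map_one, ← aeval_algebraMap_apply] at hv'
  rw [map_mul, map_sub, map_mul, ← aeval_algebraMap_apply, ← aeval_algebraMap_apply, mul_smul,
    sub_smul, ← h1, mul_smul, add_sub_cancel_left, smul_smul, hv', one_smul]

/-- If `F = k(f)` with `f` transcendental over `k`, then there is a linear form on the
differentials of `F` with `df ↦ 1`. -/
lemma exists_linearForm_D_eq_one {k F : Type*} [Field k] [Field F] [Algebra k F] {f : F}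
    (hf : k⟮f⟯ = ⊤) (htr : Transcendental k f) :
    ∃ Λ : Ω[F⁄k] →ₗ[F] F, Λ (D k F f) = 1 := by
  let : Algebra k[X] F := (aeval f).toAlgebra
  have hmap (p : k[X]) : algebraMap k[X] F p = aeval f p := rfl
  have : IsScalarTower k k[X] F := .of_algebraMap_eq fun c => by rw [hmap]; simp
  have : FaithfulSMul k[X] F :=
    (faithfulSMul_iff_algebraMap_injective _ _).2 (transcendental_iff_injective.1 htr)
  have : IsFractionRing k[X] F := IsFractionRing.of_field _ _ fun a =>
    (mem_adjoin_simple_iff k a).1 (by rw [hf]; trivial)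
  have : Algebra.FormallyEtale k[X] F := .of_isLocalization (nonZeroDivisors k[X])
  let Λ := (isBaseChange_of_formallyEtale k k[X] F).lift
    ((Algebra.linearMap k[X] F) ∘ₗ (polynomialEquiv k).toLinearMap)
  refine ⟨Λ, ?_⟩
  have h1 : D k F f = KaehlerDifferential.map k k k[X] F (D k k[X] X) := by
    rw [map_D, hmap, aeval_X]
  rw [h1, IsBaseChange.lift_eq]
  simp [polynomialEquiv_D]

end RationalDifferentials

section Genus

open KaehlerDifferential IntermediateField

variable {k : Type u} [Field k] {C : Scheme.{u}} (t : C ⟶ Spec (.of k))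

/-- The `k`-algebra structure on the local rings of a `k`-scheme. -/
@[reducible]
def stalkAlgebra (x : C) : Algebra k (C.presheaf.stalk x) :=
  ((Scheme.ΓSpecIso (.of k)).inv ≫ t.appTop ≫ C.presheaf.germ ⊤ x trivial).hom.toAlgebra

lemma stalkAlgebra_isScalarTower [IsIntegral C] (x : C) :
    letI := functionFieldAlgebra t
    letI := stalkAlgebra t x
    IsScalarTower k (C.presheaf.stalk x) C.functionField := by
  let := functionFieldAlgebra t
  let := stalkAlgebra t x
  refine .of_algebraMap_eq fun c => ?_
  have : C.presheaf.germ ⊤ x trivial ≫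
      C.presheaf.stalkSpecializes ((genericPoint_spec C).specializes trivial) =
      C.presheaf.germ ⊤ (genericPoint C) trivial := C.presheaf.germ_stalkSpecializes _ _
  change ((Scheme.ΓSpecIso (.of k)).inv ≫ t.appTop ≫
    C.presheaf.germ ⊤ (genericPoint C) trivial).hom c = _
  rw [← this]
  rfl

/-- A curve whose function field is `k(f)` has no regular differentials: if `ω = u df` is regular,
then `u` is regular where `f` is, and `f² u` is regular where `1/f` is. So `u` has no poles, hence
is constant, and it vanishes at the poles of `f`. -/
theorem regularDifferentials_eq_bot [IsIntegral C] {f : C.functionField}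
    (hval : ∀ (x : C) (a : C.functionField),
      a ∈ (algebraMap (C.presheaf.stalk x) C.functionField).range ∨
      a⁻¹ ∈ (algebraMap (C.presheaf.stalk x) C.functionField).range)
    (hconst : letI := functionFieldAlgebra t
      ∀ a : C.functionField,
        (∀ x : C, a ∈ (algebraMap (C.presheaf.stalk x) C.functionField).range) →
        ∃ c : k, algebraMap k C.functionField c = a)
    (htr : letI := functionFieldAlgebra t; Transcendental k f)
    (hf : letI := functionFieldAlgebra t; k⟮f⟯ = ⊤) :
    regularDifferentials t = ⊥ := by
  let := functionFieldAlgebra t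
  let F := C.functionField
  let O (x : C) : Subring F := (algebraMap (C.presheaf.stalk x) C.functionField).range
  change Transcendental k f at htr
  change k⟮f⟯ = ⊤ at hf
  have hf0 : f ≠ 0 := fun h0 => htr (h0 ▸ isAlgebraic_zero)
  obtain ⟨Λ, hΛ⟩ := exists_linearForm_D_eq_one hf htr
  have hinv : D k F f⁻¹ = (-(f⁻¹ * f⁻¹)) • D k F f := by
    rw [Derivation.leibniz_inv, ← pow_two]
  have loc (x : C) (g : F) (hgF : k⟮g⟯ = ⊤) (hg : g ∈ O x) {ω : Ω[F⁄k]}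
      (hω : ω ∈ regularDifferentials t) : ∃ v ∈ O x, ω = v • D k F g := by
    let := stalkAlgebra t x
    have := stalkAlgebra_isScalarTower t x
    obtain ⟨g, rfl⟩ := hg
    replace hω := (Submodule.mem_iInf _).1 hω x
    induction hω using Submodule.span_induction with
    | mem ω hω =>
      obtain ⟨a, b, rfl⟩ := hω
      obtain ⟨u, hu⟩ := exists_D_eq_smul hgF a
      exact ⟨algebraMap _ _ (b * u), ⟨_, rfl⟩, by rw [hu, smul_smul, map_mul]⟩
    | zero => exact ⟨0, zero_mem _, by rw [zero_smul]⟩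
    | add ω₁ ω₂ _ _ h₁ h₂ =>
      obtain ⟨v₁, hv₁, rfl⟩ := h₁
      obtain ⟨v₂, hv₂, rfl⟩ := h₂
      exact ⟨v₁ + v₂, add_mem hv₁ hv₂, by rw [add_smul]⟩
    | smul c ω _ h =>
      obtain ⟨v, ⟨v, rfl⟩, rfl⟩ := h
      exact ⟨algebraMap _ _ (c • v), ⟨_, rfl⟩, by
        rw [Algebra.smul_def, map_mul, mul_smul,
          ← IsScalarTower.algebraMap_apply k (C.presheaf.stalk x) F]
        exact (algebraMap_smul F c _).symm⟩
  rw [eq_bot_iff]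
  intro ω hω
  -- away from the poles of `f` the coefficient of `df` is regular; at the poles it is a regular
  -- function times `f⁻²`
  have hpole (x : C) (hx : f⁻¹ ∈ O x) :
      ∃ v ∈ O x, Λ ω = v * (f⁻¹ * f⁻¹) ∧ ω = Λ ω • D k F f := by
    obtain ⟨v, hv, rfl⟩ := loc x f⁻¹ (adjoin_inv_eq_top hf) hx hω
    refine ⟨-v, neg_mem hv, ?_⟩
    rw [hinv, smul_smul, map_smul, hΛ, smul_eq_mul, mul_one]
    exact ⟨by ring, rfl⟩
  obtain ⟨c, hc⟩ := hconst (Λ ω) fun x => by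
    rcases hval x f with hx | hx
    · obtain ⟨v, hv, rfl⟩ := loc x f hf hx hω
      rwa [map_smul, hΛ, smul_eq_mul, mul_one]
    · obtain ⟨v, hv, h, -⟩ := hpole x hx
      rw [h]
      exact mul_mem hv (mul_mem hx hx)
  obtain ⟨x, hx⟩ : ∃ x, f ∉ O x := by
    by_contra! h
    obtain ⟨a, ha⟩ := hconst f h
    exact htr (ha ▸ isAlgebraic_algebraMap a)
  have hx' := (hval x f).resolve_left hx
  obtain ⟨v, hv, h, hω'⟩ := hpole x hx'
  rcases eq_or_ne c 0 with rfl | hc0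
  · rw [Submodule.mem_bot, hω', ← hc, map_zero, zero_smul]
  refine absurd ?_ hx
  have hcx : algebraMap k F c⁻¹ ∈ O x := by
    let := stalkAlgebra t x
    have := stalkAlgebra_isScalarTower t x
    exact ⟨algebraMap k _ c⁻¹, (IsScalarTower.algebraMap_apply k (C.presheaf.stalk x) F _).symm⟩
  have hfe : f = v * f⁻¹ * algebraMap k F c⁻¹ := by
    have hcF : algebraMap k F c ≠ 0 := by simpa using hc0
    rw [map_inv₀, eq_mul_inv_iff_mul_eq₀ hcF, hc, h]
    rw [mul_left_comm, mul_inv_cancel_left₀ hf0]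
  rw [hfe]
  exact mul_mem (mul_mem hv hx') hcx

end Genus

/-! ### Cotangent spaces of smooth curves -/

section RegularLocal

open KaehlerDifferential IsLocalRing

/-- If a local `k`-algebra `A` has residue field `k`, then `m / m²` is a quotient of the module of
differentials: `a ↦ a - a(x)` is a derivation to `m / m²`. So if the differentials are generated
by one element, then `m / m²` has dimension at most one. -/
lemma finrank_cotangentSpace_le_one {k A : Type*} [Field k] [CommRing A] [IsLocalRing A]
    [Algebra k A] (hres : ∀ a : A, ∃ c : k, a - algebraMap k A c ∈ maximalIdeal A)
    {ω : Ω[A⁄k]} (hω : Submodule.span A {ω} = ⊤) :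
    Module.finrank (ResidueField A) (CotangentSpace A) ≤ 1 := by
  choose π hπ using hres
  have huniq {c : k} (hc : algebraMap k A c ∈ maximalIdeal A) : c = 0 := by
    by_contra h0
    exact (mem_maximalIdeal _).1 hc ((IsUnit.mk0 c h0).map (algebraMap k A))
  have hπeq {a : A} {c : k} (h : a - algebraMap k A c ∈ maximalIdeal A) : π a = c := by
    rw [← sub_eq_zero]
    refine huniq ?_
    have := sub_mem h (hπ a)
    rwa [sub_sub_sub_cancel_left, ← map_sub] at this
  have hadd (a b : A) : π (a + b) = π a + π b := hπeq (by
    rw [map_add, add_sub_add_comm]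
    exact add_mem (hπ a) (hπ b))
  have hsmul (c : k) (a : A) : π (c • a) = c * π a := hπeq (by
    have := Ideal.mul_mem_left _ (algebraMap k A c) (hπ a)
    rwa [mul_sub, ← map_mul, ← Algebra.smul_def] at this)
  have hmul (a b : A) : π (a * b) = π a * π b := hπeq (by
    have := add_mem (Ideal.mul_mem_left _ a (hπ b))
      (Ideal.mul_mem_left _ (algebraMap k A (π b)) (hπ a))
    convert! this using 1
    rw [map_mul]; ring)
  let d : A →ₗ[k] CotangentSpace A :=
    { toFun a := (maximalIdeal A).toCotangent ⟨_, hπ a⟩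
      map_add' a b := by
        rw [← map_add]
        congr 1
        ext
        simp [hadd]; ring
      map_smul' c a := by
        rw [RingHom.id_apply, ← algebraMap_smul A c ((maximalIdeal A).toCotangent _), ← map_smul]
        congr 1
        ext
        change c • a - algebraMap k A (π (c • a)) = algebraMap k A c * (a - algebraMap k A (π a))
        rw [hsmul, map_mul, Algebra.smul_def, mul_sub] }
  let δ : Derivation k A (CotangentSpace A) := Derivation.mk' d (by
    intro a b
    change (maximalIdeal A).toCotangent _ =
      a • (maximalIdeal A).toCotangent _ + b • (maximalIdeal A).toCotangent _
    rw [← map_smul, ← map_smul, ← map_add, Ideal.toCotangent_eq]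
    have : -((a - algebraMap k A (π a)) * (b - algebraMap k A (π b))) ∈ maximalIdeal A ^ 2 := by
      rw [pow_two]
      exact neg_mem (Ideal.mul_mem_mul (hπ a) (hπ b))
    convert! this using 1
    simp [hmul]; ring)
  refine finrank_le_one (δ.liftKaehlerDifferential ω) fun w => ?_
  obtain ⟨⟨a, ha⟩, rfl⟩ := (maximalIdeal A).toCotangent_surjective w
  have hmem : D k A a ∈ Submodule.span A {ω} := by rw [hω]; trivial
  obtain ⟨r, hr⟩ := Submodule.mem_span_singleton.1 hmem
  refine ⟨residue A r, ?_⟩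
  have h0 : π a = 0 := hπeq (by simpa using ha)
  have h1 : δ a = (maximalIdeal A).toCotangent ⟨a, ha⟩ := by
    change (maximalIdeal A).toCotangent _ = _
    congr 1
    ext
    simp [h0]
  rw [← h1, ← δ.liftKaehlerDifferential_comp_D, ← hr, map_smul]
  rfl

/-- The differentials of a localization of a standard smooth algebra of relative dimension one are
generated by one element. -/
lemma exists_span_kaehlerDifferential_eq_top {k B A : Type*} [Field k] [CommRing B] [CommRing A]
    [Algebra k B] [Algebra B A] [Algebra k A] [IsScalarTower k B A] (M : Submonoid B)
    [IsLocalization M A] [Nontrivial B]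
    [Algebra.IsStandardSmoothOfRelativeDimension 1 k B] :
    ∃ ω : Ω[A⁄k], Submodule.span A {ω} = ⊤ := by
  have : Algebra.IsStandardSmooth k B :=
    Algebra.IsStandardSmoothOfRelativeDimension.isStandardSmooth 1
  have hrank : Module.rank B Ω[B⁄k] = 1 := by
    simpa using Algebra.IsStandardSmoothOfRelativeDimension.rank_kaehlerDifferential (R := k)
      (S := B) 1
  let b := Module.basisUnique Unit (Module.rank_eq_one_iff_finrank_eq_one.1 hrank)
  refine ⟨KaehlerDifferential.map k k B A (b ()), ?_⟩
  have := span_eq_top_of_isLocalizedModule A M (KaehlerDifferential.map k k B A) (v := {b ()})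
    (by rw [← b.span_eq, Set.range_unique])
  rwa [Set.image_singleton] at this

end RegularLocal

/-! ### Points of a smooth curve -/

section CurvePoints

open IsLocalRing

variable {k : Type u} [Field k] {C : Scheme.{u}} (t : C ⟶ Spec (.of k))

lemma fromSpecStalk_comp (x : C) : C.fromSpecStalk x ≫ t =
    Spec.map ((Scheme.ΓSpecIso (.of k)).inv ≫ t.appTop ≫ C.presheaf.germ ⊤ x trivial) := by
  rw [Spec.map_comp, Spec.map_comp, ← Scheme.fromSpecStalk_toSpecΓ, Category.assoc, Category.assoc,
    ← Scheme.toSpecΓ_naturality_assoc, toSpecΓ_SpecMap_ΓSpecIso_inv, Category.comp_id]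

lemma eq_genericPoint_of_coheight_eq_zero [IsIntegral C] {x : C} (h : Order.coheight x = 0) :
    x = genericPoint C :=
  (Specializes.antisymm (Order.coheight_eq_zero.1 h (genericPoint_specializes x))
    (genericPoint_specializes x)).eq

/-- Over an algebraically closed field, the residue field at a closed point is the base field. -/
lemma exists_sub_mem_maximalIdeal [IsAlgClosed k] [LocallyOfFiniteType t] {x : C}
    (hx : IsClosed {x}) (a : C.presheaf.stalk x) :
    letI := stalkAlgebra t x
    ∃ c : k, a - algebraMap k (C.presheaf.stalk x) c ∈ maximalIdeal (C.presheaf.stalk x) := by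
  let := stalkAlgebra t x
  have h : (residueFieldIsoBase t x hx).inv =
      ((Scheme.ΓSpecIso (.of k)).inv ≫ t.appTop ≫ C.presheaf.germ ⊤ x trivial) ≫ C.residue x := by
    apply Spec.map_injective
    rw [SpecMap_residueFieldIsoBase_inv, Spec.map_comp, ← fromSpecStalk_comp]
    rfl
  refine ⟨(residueFieldIsoBase t x hx).hom (C.residue x a), ?_⟩
  rw [← residue_eq_zero_iff, map_sub, sub_eq_zero]
  have h2 : (residueFieldIsoBase t x hx).inv ((residueFieldIsoBase t x hx).hom (C.residue x a)) =
      C.residue x a := by simp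
  rw [h] at h2
  exact h2.symm

/-- The local ring of a smooth curve at a closed point other than the generic point is a discrete
valuation ring: its differentials are generated by one element, so that its cotangent space has
dimension at most one. -/
lemma isDiscreteValuationRing_stalk [IsAlgClosed k] [LocallyOfFiniteType t]
    [SmoothOfRelativeDimension 1 t] [IsIntegral C] [IsLocallyNoetherian C] {x : C}
    (hx : IsClosed {x}) (hgen : x ≠ genericPoint C) :
    IsDiscreteValuationRing (C.presheaf.stalk x) := by
  obtain ⟨U, hU, V, hV, hxV, e, hf⟩ :=
    SmoothOfRelativeDimension.exists_isStandardSmoothOfRelativeDimension (n := 1) (f := t) x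
  obtain rfl : U = ⊤ := by
    ext y
    have : y = t x := Subsingleton.elim _ _
    simpa [this] using e hxV
  have hf' := RingHom.isStandardSmoothOfRelativeDimension_respectsIso.2 _
    (Scheme.ΓSpecIso (.of k)).symm.commRingCatIsoToRingEquiv hf
  let : Algebra k (C.presheaf.stalk x) := stalkAlgebra t x
  let : Algebra k Γ(C, V) := ((t.appLE ⊤ V e).hom.comp
    ((Scheme.ΓSpecIso (.of k)).symm.commRingCatIsoToRingEquiv : k →+* _)).toAlgebra
  have : Algebra.IsStandardSmoothOfRelativeDimension 1 k Γ(C, V) := hf'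
  let : Algebra Γ(C, V) (C.presheaf.stalk x) := (C.presheaf.germ V x hxV).hom.toAlgebra
  have : Nonempty V := ⟨⟨x, hxV⟩⟩
  have hloc : IsLocalization.AtPrime (C.presheaf.stalk x) (hV.primeIdealOf ⟨x, hxV⟩).asIdeal :=
    hV.isLocalization_stalk ⟨x, hxV⟩
  have : IsScalarTower k Γ(C, V) (C.presheaf.stalk x) := .of_algebraMap_eq fun c => by
    have : t.appLE ⊤ V e ≫ C.presheaf.germ V x hxV = t.appTop ≫ C.presheaf.germ ⊤ x trivial := by
      rw [Scheme.Hom.appLE, Category.assoc, C.presheaf.germ_res]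
      rfl
    exact congr($(this).hom ((Scheme.ΓSpecIso (.of k)).inv.hom c)).symm
  obtain ⟨ω, hω⟩ := exists_span_kaehlerDifferential_eq_top (k := k) (B := Γ(C, V))
    (A := C.presheaf.stalk x) (hV.primeIdealOf ⟨x, hxV⟩).asIdeal.primeCompl
  have hfr := finrank_cotangentSpace_le_one (exists_sub_mem_maximalIdeal t hx) hω
  have hPID : IsPrincipalIdealRing (C.presheaf.stalk x) :=
    ((tfae_of_isNoetherianRing_of_isLocalRing_of_isDomain _).out 5 0).1 hfr
  refine { not_a_field' := fun h0 => hgen ?_ }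
  -- a point whose local ring is a field is generic
  have hfield : IsField (C.presheaf.stalk x) := isField_iff_maximalIdeal_eq.2 h0
  have hdim := ringKrullDim_stalk_eq_coheight x
  rw [ringKrullDim_eq_zero_of_isField hfield] at hdim
  have h1 : Order.coheight x = 0 := by exact_mod_cast hdim.symm
  exact eq_genericPoint_of_coheight_eq_zero h1

variable [IsAlgClosed k] [LocallyOfFiniteType t] [SmoothOfRelativeDimension 1 t] [IsIntegral C]
  [IsLocallyNoetherian C]

include t in
lemma coheight_eq_one {x : C} (hx : IsClosed {x}) (hgen : x ≠ genericPoint C) :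
    Order.coheight x = 1 := by
  have := isDiscreteValuationRing_stalk t hx hgen
  have h := ringKrullDim_stalk_eq_coheight x
  rw [IsDiscreteValuationRing.ringKrullDim_eq_one] at h
  exact_mod_cast h.symm

include t in
/-- The points of a curve are the generic point and closed points. -/
lemma isClosed_singleton [CompactSpace C] {x : C} (hgen : x ≠ genericPoint C) : IsClosed {x} := by
  obtain ⟨y, hy, hyc⟩ := IsClosed.exists_closed_singleton (isClosed_closure (s := {x}))
    (Set.singleton_nonempty x).closure
  have hxy : y ≤ x := specializes_iff_mem_closure.2 hy
  rcases eq_or_ne y x with rfl | hne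
  · exact hyc
  have hlt : y < x := lt_of_le_not_ge hxy fun h => hne (Specializes.antisymm h hxy).eq
  have hygen : y ≠ genericPoint C := by
    rintro rfl
    exact hlt.not_ge (genericPoint_specializes x)
  have h1 := coheight_eq_one t hyc hygen
  have h2 := Order.coheight_add_one_le hlt
  rw [h1] at h2
  have h3 : Order.coheight x = 0 := by
    have : Order.coheight x ≠ ⊤ := fun h => by simp [h] at h2
    lift Order.coheight x to ℕ using this with n
    norm_cast at h2 ⊢
    omega
  exact absurd (eq_genericPoint_of_coheight_eq_zero h3) hgen

include t in
lemma finite_of_isClosed [CompactSpace C] {Z : Set C} (hZ : IsClosed Z)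
    (hgen : genericPoint C ∉ Z) : Z.Finite := by
  have : IsNoetherian C := ⟨⟩
  obtain ⟨S, hS, hcl, hirr, rfl⟩ :=
    TopologicalSpace.NoetherianSpace.exists_finite_set_isClosed_irreducible hZ
  refine hS.sUnion fun T hT => ?_
  obtain ⟨x, hx⟩ := QuasiSober.sober (hirr T hT) (hcl T hT)
  have hxT : x ∈ T := hx.mem
  have hxc := isClosed_singleton t (x := x) (by rintro rfl; exact hgen ⟨T, hT, hxT⟩)
  rw [← hx.def, hxc.closure_eq]
  exact Set.finite_singleton x

end CurvePoints

/-! ### Orders of rational functions -/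

section StalkOrder

open IsLocalRing

variable {C : Scheme.{u}} [IsIntegral C] [IsLocallyNoetherian C]

lemma ord_algebraMap_eq_zero_of_isUnit {x : C} {a : C.presheaf.stalk x} (ha : IsUnit a) :
    C.ord (algebraMap _ C.functionField a) x = 0 := by
  by_cases hx : Order.coheight x = 1
  · have : Ring.KrullDimLE 1 (C.presheaf.stalk x) := krullDimLE_of_coheight_le hx.le
    rw [Scheme.ord_eq_iff hx (by simpa using ha.ne_zero), Scheme.ordHom,
      Ring.ordFrac_of_isUnit ha]
    rfl
  · exact Scheme.ord_eq_zero_of_coheight_neq_one hx _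

lemma ord_inv {f : C.functionField} (hf : f ≠ 0) (x : C) : C.ord f⁻¹ x = -C.ord f x := by
  have h1 := Scheme.ord_mul (x := x) hf (inv_ne_zero hf)
  have h2 := ord_algebraMap_eq_zero_of_isUnit (x := x) isUnit_one
  rw [map_one] at h2
  rw [mul_inv_cancel₀ hf] at h1
  omega

variable {x : C} [IsDiscreteValuationRing (C.presheaf.stalk x)]

lemma ord_nonneg_iff (hx : Order.coheight x = 1) {f : C.functionField} (hf : f ≠ 0) :
    0 ≤ C.ord f x ↔ f ∈ (algebraMap (C.presheaf.stalk x) C.functionField).range := by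
  rw [Scheme.le_ord_iff hx hf]
  constructor
  · intro h
    refine IsDiscreteValuationRing.exists_lift_of_le_one (A := C.presheaf.stalk x) ?_
    rw [Scheme.ordHom, Ring.ordFrac_eq_valuation_inv] at h
    rw [← inv_inv (((IsDiscreteValuationRing.maximalIdeal (C.presheaf.stalk x)).valuation _) f)]
    exact inv_le_one_of_one_le₀ h
  · rintro ⟨a, rfl⟩
    exact Ring.ordFrac_ge_one_of_ne_zero (by rintro rfl; simp at hf)

lemma ord_pos_iff (hx : Order.coheight x = 1) {a : C.presheaf.stalk x} (ha : a ≠ 0) :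
    0 < C.ord (algebraMap _ C.functionField a) x ↔ a ∈ maximalIdeal (C.presheaf.stalk x) := by
  have hf : algebraMap (C.presheaf.stalk x) C.functionField a ≠ 0 := by simpa using ha
  have h0 := (ord_nonneg_iff hx hf).2 ⟨a, rfl⟩
  have h1 : C.ord (algebraMap _ C.functionField a) x = 0 ↔ IsUnit a := by
    rw [Scheme.ord_eq_iff hx hf,
      Ring.isUnit_iff_ordFrac_one_of_isDiscreteValuationRing (K := C.functionField)]
    rfl
  rw [mem_maximalIdeal, mem_nonunits_iff, ← h1]
  omega

/-- Elements of equal order differ by a unit of the local ring. -/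
lemma exists_unit_mul_eq (hx : Order.coheight x = 1) {f g : C.functionField} (hf : f ≠ 0)
    (hg : g ≠ 0) (h : C.ord f x = C.ord g x) :
    ∃ u : (C.presheaf.stalk x)ˣ, algebraMap _ C.functionField (u : C.presheaf.stalk x) * g = f := by
  have hfg : C.ord (f * g⁻¹) x = 0 := by
    rw [Scheme.ord_mul hf (inv_ne_zero hg), ord_inv hg]; omega
  have hne : f * g⁻¹ ≠ 0 := mul_ne_zero hf (inv_ne_zero hg)
  obtain ⟨a, ha⟩ := (ord_nonneg_iff hx hne).1 hfg.ge
  have ha0 : a ≠ 0 := by rintro rfl; exact hne (by simpa using ha.symm)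
  have hu : IsUnit a := by
    by_contra hn
    have := (ord_pos_iff hx ha0).2 hn
    rw [ha] at this
    omega
  exact ⟨hu.unit, by rw [hu.unit_spec, ha, inv_mul_cancel_right₀ hg]⟩

end StalkOrder

section Global

/-- On an integral scheme, a rational function that is regular at every point is a global
function. -/
lemma exists_germ_eq_of_forall_mem_range {C : Scheme.{u}} [IsIntegral C] {f : C.functionField}
    (hf : ∀ x : C, f ∈ (algebraMap (C.presheaf.stalk x) C.functionField).range) :
    ∃ s : Γ(C, ⊤), C.presheaf.germ ⊤ (genericPoint C) trivial s = f := by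
  have hloc (x : C) : ∃ (U : C.Opens) (hx : x ∈ U) (hη : genericPoint C ∈ U) (s : Γ(C, U)),
      C.presheaf.germ U (genericPoint C) hη s = f := by
    obtain ⟨a, rfl⟩ := hf x
    obtain ⟨U, hU, s, rfl⟩ := C.presheaf.exists_germ_eq a
    have : Nonempty U := ⟨⟨x, hU⟩⟩
    exact ⟨U, hU, _, s, (C.algebraMap_germ_eq_germToFunctionField hU s).symm⟩
  choose U hx hη s hs using hloc
  have hcomp : TopCat.Presheaf.IsCompatible C.presheaf U s := fun x y => by
    apply germ_injective_of_isIntegral C (U := U x ⊓ U y) (genericPoint C) ⟨hη x, hη y⟩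
    exact ((TopCat.Presheaf.germ_res_apply C.presheaf _ _ _ _).trans (hs x)).trans
      ((TopCat.Presheaf.germ_res_apply C.presheaf _ _ _ _).trans (hs y)).symm
  obtain ⟨g, hg, -⟩ := C.sheaf.existsUnique_gluing' U ⊤ (fun x => homOfLE le_top)
    (fun x _ => TopologicalSpace.Opens.mem_iSup.2 ⟨x, hx x⟩) s hcomp
  refine ⟨g, ?_⟩
  have x : C := genericPoint C
  rw [← hs x, ← hg x]
  exact (TopCat.Presheaf.germ_res_apply C.presheaf _ _ (hη x) _).symm

/-- A rational function without poles on a proper integral scheme over an algebraically closed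
field is constant. -/
lemma exists_algebraMap_eq {k : Type u} [Field k] [IsAlgClosed k] {C : Scheme.{u}}
    (t : C ⟶ Spec (.of k)) [IsIntegral C] [IsProper t] {f : C.functionField}
    (hf : ∀ x : C, f ∈ (algebraMap (C.presheaf.stalk x) C.functionField).range) :
    letI := functionFieldAlgebra t
    ∃ c : k, algebraMap k C.functionField c = f := by
  let := functionFieldAlgebra t
  obtain ⟨s, rfl⟩ := exists_germ_eq_of_forall_mem_range hf
  let φ : k →+* Γ(C, ⊤) := ((Scheme.ΓSpecIso (.of k)).inv ≫ t.appTop).hom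
  have hφ : φ.IsIntegral := by
    have h1 := (finite_appTop_of_universallyClosed k t).to_isIntegral
    apply RingHom.isIntegral_respectsIso.2 (e := (Scheme.ΓSpecIso _).symm.commRingCatIsoToRingEquiv)
    exact h1
  obtain ⟨c, rfl⟩ := (IsAlgClosed.ringHom_bijective_of_isIntegral φ hφ).2 s
  exact ⟨c, rfl⟩

end Global

section OrderFamily

open IsLocalRing

variable {k : Type u} [Field k] [IsAlgClosed k] {C : Scheme.{u}} (t : C ⟶ Spec (.of k))
  [IsProper t] [SmoothOfRelativeDimension 1 t] [IsIntegral C] [IsLocallyNoetherian C]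

include t in
/-- The local rings of a curve are valuation rings of its function field. -/
lemma mem_range_or_inv_mem_range [CompactSpace C] (x : C)
    (f : C.functionField) :
    f ∈ (algebraMap (C.presheaf.stalk x) C.functionField).range ∨
      f⁻¹ ∈ (algebraMap (C.presheaf.stalk x) C.functionField).range := by
  by_cases hf : f = 0
  · exact .inl (hf ▸ zero_mem _)
  by_cases hx : x = genericPoint C
  · subst hx
    exact .inl ⟨f, congr($(C.presheaf.stalkSpecializes_refl _).hom f)⟩
  have hc := isClosed_singleton t hx
  have := isDiscreteValuationRing_stalk t hc hx
  have h1 := coheight_eq_one t hc hx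
  rw [← ord_nonneg_iff h1 hf, ← ord_nonneg_iff h1 (inv_ne_zero hf), ord_inv hf]
  omega

/-- The orders at the closed points of a complete smooth curve over an algebraically closed field
form an order family. The closed points are indexed by a type `S`. -/
theorem isOrderFamily (hη : ¬ IsClosed {genericPoint C}) [CompactSpace C] {S : Type*} {pt : S → C}
    (hinj : Function.Injective pt) (hcl : ∀ p, IsClosed {pt p})
    (hsurj : ∀ x : C, IsClosed {x} → ∃ p, pt p = x) :
    letI := functionFieldAlgebra t
    IsOrderFamily k (fun (p : S) (f : C.functionField) => C.ord f (pt p)) := by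
  let := functionFieldAlgebra t
  have hgen (p : S) : pt p ≠ genericPoint C := fun h => hη (h ▸ hcl p)
  have hco (p : S) := coheight_eq_one t (hcl p) (hgen p)
  have hdvr (p : S) := isDiscreteValuationRing_stalk t (hcl p) (hgen p)
  refine ⟨fun p f g hf hg => Scheme.ord_mul hf hg, fun p f g hfg _ _ => Scheme.ord_add hfg,
    fun p c hc => ?_, fun p f g hf hg h => ?_, fun {f} hf => ?_, fun {f} hf h => ?_⟩
  · let := stalkAlgebra t (pt p)
    have := stalkAlgebra_isScalarTower t (pt p)
    rw [IsScalarTower.algebraMap_apply k (C.presheaf.stalk (pt p)) C.functionField]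
    exact ord_algebraMap_eq_zero_of_isUnit ((IsUnit.mk0 c hc).map _)
  · let := stalkAlgebra t (pt p)
    have := stalkAlgebra_isScalarTower t (pt p)
    obtain ⟨u, rfl⟩ := exists_unit_mul_eq (hco p) hf hg h
    obtain ⟨c, hc⟩ := exists_sub_mem_maximalIdeal t (hcl p) (u : C.presheaf.stalk (pt p))
    have heq : algebraMap _ C.functionField (u : C.presheaf.stalk (pt p)) * g - c • g =
        algebraMap _ C.functionField ((u : C.presheaf.stalk (pt p)) - algebraMap k _ c) * g := by
      rw [map_sub, sub_mul, Algebra.smul_def,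
        IsScalarTower.algebraMap_apply k (C.presheaf.stalk (pt p)) C.functionField]
    refine ⟨c, ?_⟩
    rw [heq]
    by_cases h0 : (u : C.presheaf.stalk (pt p)) - algebraMap k _ c = 0
    · left; rw [h0, map_zero, zero_mul]
    right
    have h1 := (ord_pos_iff (hco p) h0).2 hc
    have h2 : algebraMap _ C.functionField
        ((u : C.presheaf.stalk (pt p)) - algebraMap k _ c) ≠ 0 :=
      fun h => h0 (FaithfulSMul.algebraMap_injective _ _ (h.trans (map_zero _).symm))
    rw [Scheme.ord_mul h2 hg, Scheme.ord_mul (by simp) hg,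
      ord_algebraMap_eq_zero_of_isUnit u.isUnit]
    omega
  · obtain ⟨U, -, s, hU, hs, hunit⟩ := exists_isUnit_germ_eq C f hf
    have hfin := finite_of_isClosed t (Z := (U : Set C)ᶜ) U.isOpen.isClosed_compl
      (by rw [Set.notMem_compl_iff]
          exact ((genericPoint_spec C).mem_open_set_iff U.isOpen).mpr (by simpa using hU))
    refine (hfin.preimage hinj.injOn).subset fun p hp hpU => ?_
    rw [Set.mem_ofPred_eq, ← hs, Scheme.ord_of_isUnit hunit hpU] at hp
    exact lt_irrefl _ hp
  · refine exists_algebraMap_eq t fun x => ?_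
    by_cases hx : x = genericPoint C
    · subst hx
      exact ⟨f, congr($(C.presheaf.stalkSpecializes_refl _).hom f)⟩
    obtain ⟨p, rfl⟩ := hsurj x (isClosed_singleton t hx)
    exact (ord_nonneg_iff (hco p) hf).1 (h p)

end OrderFamily

/-! ### Extending morphisms from the generic point -/

section Extension

open Scheme

/-- A partial map that is defined everywhere is a morphism. -/
lemma exists_hom_of_domain_eq_top {X Y : Scheme.{u}} (p : X.PartialMap Y) (hp : p.domain = ⊤) :
    ∃ φ : X ⟶ Y, ∀ (U : X.Opens) (hU : U ≤ p.domain), X.homOfLE hU ≫ p.hom = U.ι ≫ φ := by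
  obtain ⟨D, hD, h⟩ := p
  obtain rfl : D = ⊤ := hp
  refine ⟨X.topIso.inv ≫ h, fun U hU => ?_⟩
  rw [← Category.assoc]
  congr 1
  rw [← cancel_mono (Opens.ι _), X.homOfLE_ι, Category.assoc, ← X.topIso_hom, X.topIso.inv_hom_id,
    Category.comp_id]

/-- A morphism over `S` from the generic point of an integral scheme `X` to a separated scheme `Y`
locally of finite type extends to `X` as soon as it extends to every local scheme `Spec 𝒪_x`, since
the extensions spread out to open neighbourhoods and agree on overlaps. -/
theorem exists_hom_of_fromSpecStalk {S X Y : Scheme.{u}} [IsIntegral X] [Y.IsSeparated]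
    (sX : X ⟶ S) (sY : Y ⟶ S) [LocallyOfFiniteType sY]
    (ψ : ∀ x : X, Spec (X.presheaf.stalk x) ⟶ Y)
    (hψ : ∀ x, ψ x ≫ sY = X.fromSpecStalk x ≫ sX)
    (hgen : ∀ x, Spec.map (X.presheaf.stalkSpecializes (genericPoint_specializes x)) ≫ ψ x =
      ψ (genericPoint X)) :
    ∃ φ : X ⟶ Y, φ ≫ sY = sX ∧ ∀ x, X.fromSpecStalk x ≫ φ = ψ x := by
  let R (x : X) : X.PartialMap Y := PartialMap.ofFromSpecStalk sX sY (ψ x) (hψ x)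
  have hmem (x : X) : x ∈ (R x).domain := PartialMap.mem_domain_ofFromSpecStalk ..
  have hR (x : X) : (R x).fromSpecStalkOfMem (hmem x) = ψ x :=
    PartialMap.fromSpecStalkOfMem_ofFromSpecStalk ..
  have hff (x : X) : (R x).fromFunctionField = ψ (genericPoint X) := by
    rw [← hgen x, ← hR x, PartialMap.fromFunctionField, PartialMap.fromSpecStalkOfMem,
      PartialMap.fromSpecStalkOfMem, ← Category.assoc]
    congr 1
    rw [← cancel_mono (Opens.ι _), Category.assoc, Opens.fromSpecStalkOfMem_ι,
      Opens.fromSpecStalkOfMem_ι, SpecMap_stalkSpecializes_fromSpecStalk]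
  let f : X ⤏ Y := (R (genericPoint X)).toRationalMap
  have hf (x : X) : (R x).toRationalMap = f :=
    RationalMap.eq_of_fromFunctionField_eq _ _ (by
      rw [RationalMap.fromFunctionField_toRationalMap,
        RationalMap.fromFunctionField_toRationalMap, hff, hff])
  have hdom : f.domain = ⊤ :=
    top_unique fun x _ => RationalMap.mem_domain.mpr ⟨R x, hmem x, hf x⟩
  obtain ⟨φ, hφ⟩ := exists_hom_of_domain_eq_top f.toPartialMap hdom
  have hRφ (x : X) : (R x).hom = (R x).domain.ι ≫ φ := by
    rw [← (R x).toPartialMap_toRationalMap_restrict,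
      ← hφ _ ((hf x).symm ▸ (R x).le_domain_toRationalMap)]
    have key : ∀ (g : X ⤏ Y) (h1 : (R x).domain ≤ g.toPartialMap.domain)
        (h2 : (R x).domain ≤ f.toPartialMap.domain), g = f →
        (g.toPartialMap.restrict _ (R x).dense_domain h1).hom =
          X.homOfLE h2 ≫ f.toPartialMap.hom := by
      rintro g h1 h2 rfl
      rfl
    exact key _ _ _ (hf x)
  refine ⟨φ, ?_, fun x => ?_⟩
  · have hcov : TopologicalSpace.IsOpenCover fun x => (R x).domain :=
      top_unique fun x _ => TopologicalSpace.Opens.mem_iSup.mpr ⟨x, hmem x⟩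
    have h (x : X) : (R x).domain.ι ≫ φ ≫ sY = (R x).domain.ι ≫ sX := by
      rw [← Category.assoc, ← hRφ]
      exact PartialMap.ofFromSpecStalk_comp sX sY (ψ x) (hψ x)
    exact (X.openCoverOfIsOpenCover _ hcov).hom_ext _ _ h
  · rw [← hR x, PartialMap.fromSpecStalkOfMem, hRφ, ← Category.assoc, Opens.fromSpecStalkOfMem_ι]

end Extension

/-! ### Points of Proj -/

section PointsOfProj

open HomogeneousLocalization

variable {A : Type u} [CommRing A] {σ : Type*} [SetLike σ A] [AddSubgroupClass σ A]
  {𝒜 : ℕ → σ} [GradedRing 𝒜] {R S : Type u} [CommRing R] [CommRing S]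

variable (𝒜) in
/-- The evaluation `A_(x) → R` on the degree zero part of `A_x` of a ring homomorphism `e : A → R`
for which `e x` is a unit. -/
def evalAway (e : A →+* R) (x : A) (hx : IsUnit (e x)) : Away 𝒜 x →+* R :=
  (Localization.awayLift e x hx).comp (algebraMap (Away 𝒜 x) (Localization.Away x))

lemma evalAway_mk_mul (e : A →+* R) {x : A} (hx : IsUnit (e x)) {d : ℕ} (hd : x ∈ 𝒜 d) (n : ℕ)
    (a : A) (ha : a ∈ 𝒜 (n • d)) : evalAway 𝒜 e x hx (Away.mk 𝒜 hd n a ha) * e x ^ n = e a := by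
  obtain ⟨v, hv⟩ := isUnit_iff_exists_inv.mp hx
  have h : evalAway 𝒜 e x hx (Away.mk 𝒜 hd n a ha) = e a * v ^ n :=
    Localization.awayLift_mk e x a v hv n
  rw [h, mul_assoc, ← mul_pow, mul_comm v, hv, one_pow, mul_one]

lemma evalAway_fromZero (e : A →+* R) {x : A} (hx : IsUnit (e x)) (a : 𝒜 0) :
    evalAway 𝒜 e x hx (fromZeroRingHom 𝒜 _ a) = e a := by
  have h : evalAway 𝒜 e x hx (fromZeroRingHom 𝒜 _ a) =
    Localization.awayLift e x hx (algebraMap A _ a) := rfl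
  rw [h, Localization.awayLift, IsLocalization.Away.lift_eq]

lemma evalAway_eq_of_smul {e e' : A →+* R} {x : A} (hx : IsUnit (e x)) (hx' : IsUnit (e' x))
    {d : ℕ} (hd : x ∈ 𝒜 d) {c : R} (hc : ∀ n, ∀ a ∈ 𝒜 n, e' a = c ^ n * e a) :
    evalAway 𝒜 e' x hx' = evalAway 𝒜 e x hx := by
  ext z
  obtain ⟨n, a, ha, rfl⟩ := Away.mk_surjective 𝒜 hd z
  refine (hx'.pow n).mul_right_cancel ?_
  rw [evalAway_mk_mul, hc _ _ ha, hc _ _ hd, mul_pow, ← pow_mul, mul_left_comm, evalAway_mk_mul,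
    smul_eq_mul, mul_comm n]

lemma comp_evalAway (g : R →+* S) (e : A →+* R) {x : A} (hx : IsUnit (e x)) :
    g.comp (evalAway 𝒜 e x hx) = evalAway 𝒜 (g.comp e) x (hx.map g) := by
  rw [evalAway, ← RingHom.comp_assoc, evalAway]
  congr 1
  refine IsLocalization.ringHom_ext (M := .powers x) ?_
  ext a
  simp [Localization.awayLift, IsLocalization.Away.lift_eq]

lemma evalAway_comp_awayMap (e : A →+* R) {x y z : A} {d' : ℕ}
    (hd' : y ∈ 𝒜 d') (hz : z = x * y) (hx : IsUnit (e x)) (hze : IsUnit (e z)) :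
    (evalAway 𝒜 e z hze).comp (awayMap 𝒜 hd' hz) = evalAway 𝒜 e x hx := by
  have h : Localization.awayLift e x hx = (Localization.awayLift e z hze).comp
      (Localization.awayLift (algebraMap A _) _
        (isUnit_of_dvd_unit (map_dvd _ ⟨_, hz⟩) (IsLocalization.Away.algebraMap_isUnit z))) := by
    refine IsLocalization.ringHom_ext (M := .powers x) ?_
    ext a
    simp [Localization.awayLift, IsLocalization.Away.lift_eq]
  ext a
  rw [evalAway, evalAway, h, RingHom.comp_apply, RingHom.comp_apply, RingHom.comp_apply,
    RingHom.comp_apply, HomogeneousLocalization.algebraMap_apply, val_awayMap]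
  rfl

variable (𝒜) in
/-- The point `Spec R ⟶ Proj 𝒜` given by a ring homomorphism `e : A → R` that sends the homogeneous
element `x` of positive degree to a unit: in homogeneous coordinates, the point with the
coordinates `e a`. -/
def projPoint (e : A →+* R) {x : A} {d : ℕ} (hd : x ∈ 𝒜 d) (hd0 : 0 < d) (hx : IsUnit (e x)) :
    Spec (.of R) ⟶ Proj 𝒜 :=
  Spec.map (CommRingCat.ofHom (evalAway 𝒜 e x hx)) ≫ Proj.awayι 𝒜 x hd hd0

lemma projPoint_toSpecZero (e : A →+* R) {x : A} {d : ℕ} (hd : x ∈ 𝒜 d) (hd0 : 0 < d)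
    (hx : IsUnit (e x)) : projPoint 𝒜 e hd hd0 hx ≫ Proj.toSpecZero 𝒜 =
      Spec.map (CommRingCat.ofHom (e.comp (algebraMap (𝒜 0) A))) := by
  rw [projPoint, Category.assoc, Proj.awayι_toSpecZero, ← Spec.map_comp, ← CommRingCat.ofHom_comp]
  congr 2
  ext a
  exact evalAway_fromZero e hx a

lemma Spec_map_projPoint (g : R →+* S) (e : A →+* R) {x : A} {d : ℕ} (hd : x ∈ 𝒜 d) (hd0 : 0 < d)
    (hx : IsUnit (e x)) : Spec.map (CommRingCat.ofHom g) ≫ projPoint 𝒜 e hd hd0 hx =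
      projPoint 𝒜 (g.comp e) hd hd0 (hx.map g) := by
  rw [projPoint, projPoint, ← Category.assoc, ← Spec.map_comp, ← CommRingCat.ofHom_comp,
    comp_evalAway]

lemma projPoint_eq_projPoint_mul (e : A →+* R) {x y z : A} {d d' : ℕ} (hd : x ∈ 𝒜 d) (hd0 : 0 < d)
    (hd' : y ∈ 𝒜 d') (hz : z = x * y) (hx : IsUnit (e x)) (hze : IsUnit (e z)) :
    projPoint 𝒜 e hd hd0 hx = projPoint 𝒜 e (hz ▸ SetLike.mul_mem_graded hd hd')
      (Nat.add_pos_left hd0 _) hze := by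
  rw [projPoint, projPoint, ← evalAway_comp_awayMap e hd' hz hx hze, CommRingCat.ofHom_comp,
    Spec.map_comp, Category.assoc, Proj.SpecMap_awayMap_awayι]

/-- The point given by `e` does not depend on the chart. -/
lemma projPoint_eq (e : A →+* R) {x y : A} {d d' : ℕ} (hd : x ∈ 𝒜 d) (hd0 : 0 < d)
    (hd' : y ∈ 𝒜 d') (hd0' : 0 < d') (hx : IsUnit (e x)) (hy : IsUnit (e y)) :
    projPoint 𝒜 e hd hd0 hx = projPoint 𝒜 e hd' hd0' hy := by
  have h : IsUnit (e (x * y)) := by rw [map_mul]; exact hx.mul hy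
  rw [projPoint_eq_projPoint_mul e hd hd0 hd' rfl hx h,
    projPoint_eq_projPoint_mul e hd' hd0' hd (mul_comm x y) hy h]
  rfl

/-- The point given by `e` does not change if the coordinates are multiplied by a common factor. -/
lemma projPoint_eq_of_smul {e e' : A →+* R} {x : A} {d : ℕ} (hd : x ∈ 𝒜 d) (hd0 : 0 < d)
    (hx : IsUnit (e x)) (hx' : IsUnit (e' x)) {c : R} (hc : ∀ n, ∀ a ∈ 𝒜 n, e' a = c ^ n * e a) :
    projPoint 𝒜 e' hd hd0 hx' = projPoint 𝒜 e hd hd0 hx := by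
  rw [projPoint, projPoint, evalAway_eq_of_smul hx hx' hd hc]

end PointsOfProj

/-! ### Stalk maps -/

section StalkMap

open IsLocalRing

/-- Let a local homomorphism `τ : 𝒪_{Y, y} → B` and a homomorphism `e : A → B` define the same
`B`-valued point of `Y`, where `Spec A` is an open subscheme of `Y`. Then `e` factors through `τ`,
and `𝒪_{Y, y}` consists of fractions of elements of `A`. -/
theorem exists_comp_eq_of_fromSpecStalk {Y : Scheme.{u}} {A B : CommRingCat.{u}} [IsLocalRing B]
    (e : A ⟶ B) (j : Spec A ⟶ Y) [IsOpenImmersion j] {y : Y} (τ : Y.presheaf.stalk y ⟶ B)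
    [IsLocalHom τ.hom] (h : Spec.map τ ≫ Y.fromSpecStalk y = Spec.map e ≫ j) :
    ∃ κ : A →+* Y.presheaf.stalk y, (∀ a, τ (κ a) = e a) ∧
      ∀ r, ∃ a b, r * κ b = κ a ∧ IsUnit (κ b) := by
  let c : Spec B := closedPoint B
  have hy : y = j (Spec.map e c) := by
    have h1 : Y.fromSpecStalk y (Spec.map τ c) = j (Spec.map e c) := congr($h c)
    have h2 : Spec.map τ c = closedPoint (Y.presheaf.stalk y) := comap_closedPoint τ.hom
    rw [← h1, h2, Scheme.fromSpecStalk_closedPoint]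
  generalize Spec.map e c = z at hy
  subst hy
  let κ : A ⟶ (Spec A).presheaf.stalk z := StructureSheaf.toStalk A z
  let : Algebra A ((Spec A).presheaf.stalk z) := StructureSheaf.stalkAlgebra A z
  have : z.asIdeal.IsPrime := PrimeSpectrum.isPrime z
  have : IsLocalization.AtPrime ((Spec A).presheaf.stalk z) z.asIdeal :=
    StructureSheaf.IsLocalization.to_stalk A z
  let τ' : (Spec A).presheaf.stalk z ⟶ B := inv (j.stalkMap z) ≫ τ
  have hτ : j.stalkMap z ≫ τ' = τ := by simp [τ']
  have he : e = κ ≫ τ' := by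
    apply Spec.map_injective
    have h3 : (Spec A).fromSpecStalk z = Spec.map κ := Spec.fromSpecStalk_eq' A z
    have h4 : (Spec.map τ' ≫ (Spec A).fromSpecStalk z) ≫ j = Spec.map e ≫ j := by
      rw [Category.assoc, ← Scheme.SpecMap_stalkMap_fromSpecStalk, ← Category.assoc,
        ← Spec.map_comp, hτ, h]
    rw [Spec.map_comp κ τ', ← h3, (cancel_mono j).mp h4]
  have hinv (r) : inv (j.stalkMap z) (j.stalkMap z r) = r :=
    congr($(IsIso.hom_inv_id (j.stalkMap z)) r)
  refine ⟨(κ ≫ inv (j.stalkMap z)).hom, fun a => congr($he.symm a), fun r => ?_⟩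
  obtain ⟨⟨a, b⟩, hab⟩ := IsLocalization.surj z.asIdeal.primeCompl (j.stalkMap z r)
  refine ⟨a, b, ?_, ?_⟩
  · have h5 := congrArg (inv (j.stalkMap z)) hab
    rw [map_mul, hinv] at h5
    exact h5
  · exact (IsLocalization.map_units ((Spec A).presheaf.stalk z) b).map (inv (j.stalkMap z)).hom

end StalkMap

/-! ### Points of the projective line -/

section ProjectiveLine

attribute [local instance] MvPolynomial.gradedAlgebra

open MvPolynomial

variable (k : Type u) [Field k]

variable {k} in
lemma X_mem_homogeneousSubmodule (i : Fin 2) :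
    (X i : MvPolynomial (Fin 2) k) ∈ homogeneousSubmodule (Fin 2) k 1 :=
  isHomogeneous_X k i

instance : (P1 k).IsSeparated :=
  inferInstanceAs (Proj (homogeneousSubmodule (Fin 2) k)).IsSeparated

instance : LocallyOfFiniteType (P1.toSpec k) := by
  have : IsScalarTower k (homogeneousSubmodule (Fin 2) k 0) (MvPolynomial (Fin 2) k) :=
    ⟨fun a b c => by
      rw [Algebra.smul_def b, Algebra.smul_def (a • b), ← smul_mul_assoc]
      rfl⟩
  have : Algebra.FiniteType (homogeneousSubmodule (Fin 2) k 0) (MvPolynomial (Fin 2) k) :=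
    .of_restrictScalars_finiteType k _ _
  have hsurj : Function.Surjective (algebraMap k (homogeneousSubmodule (Fin 2) k 0)) := by
    rintro ⟨p, hp⟩
    rw [homogeneousSubmodule_zero] at hp
    obtain ⟨c, rfl⟩ := Submodule.mem_one.mp hp
    exact ⟨c, rfl⟩
  have : IsClosedImmersion (Spec.map (CommRingCat.ofHom
      (algebraMap k (homogeneousSubmodule (Fin 2) k 0)))) :=
    IsClosedImmersion.spec_of_surjective _ hsurj
  exact inferInstanceAs (LocallyOfFiniteType (Proj.toSpecZero (homogeneousSubmodule (Fin 2) k) ≫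
    Spec.map (CommRingCat.ofHom (algebraMap k (homogeneousSubmodule (Fin 2) k 0)))))

variable {k}

lemma _root_.MvPolynomial.IsHomogeneous.eval₂Hom_smul {ι A R : Type*} [Fintype ι] [CommSemiring A]
    [CommSemiring R] {p : MvPolynomial ι A} {n : ℕ} (hp : p.IsHomogeneous n) (ρ : A →+* R) (c : R)
    (v : ι → R) : eval₂Hom ρ (c • v) p = c ^ n * eval₂Hom ρ v p := by
  rw [coe_eval₂Hom, coe_eval₂Hom, eval₂_eq', eval₂_eq', Finset.mul_sum]
  refine Finset.sum_congr rfl fun d hd => ?_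
  have hdeg : ∑ i, d i = n := by
    by_contra h
    refine mem_support_iff.mp hd (hp.coeff_eq_zero ?_)
    rwa [Finsupp.degree_eq_sum]
  simp only [Pi.smul_apply, smul_eq_mul, mul_pow, Finset.prod_mul_distrib,
    Finset.prod_pow_eq_pow_sum, hdeg]
  ring

variable {R S : Type u} [CommRing R] [CommRing S]

/-- The point of the projective line over `k` with the homogeneous coordinates `v 0`, `v 1` in a
`k`-algebra `R`, one of which is a unit. -/
def P1.point (ρ : k →+* R) (v : Fin 2 → R) (i : Fin 2) (hv : IsUnit (v i)) :
    Spec (.of R) ⟶ P1 k :=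
  projPoint (homogeneousSubmodule (Fin 2) k) (eval₂Hom ρ v) (X_mem_homogeneousSubmodule i) one_pos
    (by rwa [eval₂Hom_X'])

lemma P1.point_toSpec (ρ : k →+* R) (v : Fin 2 → R) (i : Fin 2) (hv : IsUnit (v i)) :
    P1.point ρ v i hv ≫ P1.toSpec k = Spec.map (CommRingCat.ofHom ρ) := by
  refine (Category.assoc (projPoint (homogeneousSubmodule (Fin 2) k) (eval₂Hom ρ v)
    (X_mem_homogeneousSubmodule i) one_pos (by rwa [eval₂Hom_X'])) _ _).symm.trans ?_
  rw [projPoint_toSpecZero, ← Spec.map_comp, ← CommRingCat.ofHom_comp]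
  have h (a : k) : eval₂Hom ρ v (C a) = ρ a := eval₂Hom_C ρ v a
  exact congrArg (fun g => Spec.map (CommRingCat.ofHom g)) (RingHom.ext h)

lemma P1.Spec_map_point (g : R →+* S) (ρ : k →+* R) (v : Fin 2 → R) (i : Fin 2)
    (hv : IsUnit (v i)) : Spec.map (CommRingCat.ofHom g) ≫ P1.point ρ v i hv =
      P1.point (g.comp ρ) (g ∘ v) i (hv.map g) := by
  rw [P1.point, P1.point]
  erw [Spec_map_projPoint]
  congr 1
  ext <;> simp

lemma P1.point_eq (ρ : k →+* R) (v : Fin 2 → R) (i j : Fin 2) (hi : IsUnit (v i))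
    (hj : IsUnit (v j)) : P1.point ρ v i hi = P1.point ρ v j hj :=
  projPoint_eq ..

lemma P1.point_smul (ρ : k →+* R) (v : Fin 2 → R) (i : Fin 2) (c : R) (hi : IsUnit (v i))
    (hc : IsUnit ((c • v) i)) : P1.point ρ (c • v) i hc = P1.point ρ v i hi :=
  projPoint_eq_of_smul _ _ _ _ fun _ _ ha => IsHomogeneous.eval₂Hom_smul ha ρ c v

lemma P1.point_affine_eq (ρ : k →+* R) {a b : R} (h : b * a = 1) :
    P1.point ρ ![b, 1] 1 isUnit_one = P1.point ρ ![1, a] 0 isUnit_one := by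
  have ha : IsUnit a := IsUnit.of_mul_eq_one_right b h
  have hv : b • ![1, a] = ![b, 1] := by ext i; fin_cases i <;> simp [h]
  rw [P1.point_eq ρ ![1, a] 0 1 isUnit_one ha, ← P1.point_smul ρ ![1, a] 1 b ha (by simp [h])]
  congr 1
  exact hv.symm

end ProjectiveLine

/-! ### Maps from a curve to the projective line -/

section MapsToProjectiveLine

attribute [local instance] MvPolynomial.gradedAlgebra

open MvPolynomial HomogeneousLocalization

variable {k : Type u} [Field k] {C : Scheme.{u}} [IsIntegral C] (t : C ⟶ Spec (.of k))

/-- The inclusion of the constants in the local ring at `x`. -/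
def constHom (x : C) : k →+* C.presheaf.stalk x :=
  ((Scheme.ΓSpecIso (.of k)).inv ≫ t.appTop ≫ C.presheaf.germ ⊤ x trivial).hom

lemma algebraMap_comp_constHom (x : C) :
    (algebraMap (C.presheaf.stalk x) C.functionField).comp (constHom t x) =
      constHom t (genericPoint C) := by
  ext c
  have h := C.presheaf.germ_stalkSpecializes (U := ⊤) (x := genericPoint C) (y := x) trivial
    ((genericPoint_spec C).specializes trivial)
  exact congr($h ((Scheme.ΓSpecIso (.of k)).inv ≫ t.appTop |>.hom c))

/-- A rational function `f` that is regular or has a regular inverse at every point defines a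
morphism to the projective line, given by `f` in the coordinate `X 1 / X 0`. -/
theorem exists_hom_P1 {f : C.functionField} (hf : f ≠ 0)
    (h : ∀ x : C, f ∈ (algebraMap (C.presheaf.stalk x) C.functionField).range ∨
      f⁻¹ ∈ (algebraMap (C.presheaf.stalk x) C.functionField).range) :
    ∃ φ : C ⟶ P1 k, φ ≫ P1.toSpec k = t ∧
      C.fromSpecStalk (genericPoint C) ≫ φ =
        P1.point (R := C.functionField) (constHom t (genericPoint C)) ![1, f] 0 isUnit_one ∧
      ∀ (x : C) (b : C.presheaf.stalk x), algebraMap _ C.functionField b = f⁻¹ →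
        C.fromSpecStalk x ≫ φ =
          P1.point (R := C.presheaf.stalk x) (constHom t x) ![b, 1] 1 isUnit_one := by
  let N : Spec C.functionField ⟶ P1 k :=
    P1.point (R := C.functionField) (constHom t (genericPoint C)) ![1, f] 0 isUnit_one
  have hmap (x : C) (v : Fin 2 → C.presheaf.stalk x) (i : Fin 2) (hv : IsUnit (v i)) :
      Spec.map (C.presheaf.stalkSpecializes (genericPoint_specializes x)) ≫
        P1.point (R := C.presheaf.stalk x) (constHom t x) v i hv =
          P1.point (R := C.functionField) (constHom t (genericPoint C))
          (algebraMap _ C.functionField ∘ v) i (hv.map _) := by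
    have := P1.Spec_map_point (algebraMap (C.presheaf.stalk x) C.functionField) (constHom t x) v i
      hv
    simp only [algebraMap_comp_constHom] at this
    exact this
  have key (x : C) : ∃ ψ : Spec (C.presheaf.stalk x) ⟶ P1 k,
      ψ ≫ P1.toSpec k = C.fromSpecStalk x ≫ t ∧
      Spec.map (C.presheaf.stalkSpecializes (genericPoint_specializes x)) ≫ ψ = N ∧
      ∀ b : C.presheaf.stalk x, algebraMap _ C.functionField b = f⁻¹ →
        ψ = P1.point (R := C.presheaf.stalk x) (constHom t x) ![b, 1] 1 isUnit_one := by
    by_cases hx : f ∈ (algebraMap (C.presheaf.stalk x) C.functionField).range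
    · obtain ⟨a, ha⟩ := hx
      refine ⟨P1.point (R := C.presheaf.stalk x) (constHom t x) ![1, a] 0 isUnit_one,
        ?_, ?_, fun b hb => ?_⟩
      · exact (P1.point_toSpec _ _ _ _).trans (fromSpecStalk_comp t x).symm
      · refine (hmap x _ _ _).trans ?_
        congr 1
        ext i
        fin_cases i <;> simp [ha]
      · refine (P1.point_affine_eq (R := C.presheaf.stalk x) _ ?_).symm
        apply IsFractionRing.injective (C.presheaf.stalk x) C.functionField
        rw [map_mul, map_one, ha, hb, inv_mul_cancel₀ hf]
    · obtain ⟨b, hb⟩ := (h x).resolve_left hx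
      refine ⟨P1.point (R := C.presheaf.stalk x) (constHom t x) ![b, 1] 1 isUnit_one,
        ?_, ?_, fun b' hb' => ?_⟩
      · exact (P1.point_toSpec _ _ _ _).trans (fromSpecStalk_comp t x).symm
      · refine (hmap x _ _ _).trans (Eq.trans ?_
          (P1.point_affine_eq (R := C.functionField) _ (b := f⁻¹) (inv_mul_cancel₀ hf)))
        congr 1
        ext i
        fin_cases i <;> simp [hb]
      · obtain rfl := IsFractionRing.injective (C.presheaf.stalk x) C.functionField
          (hb'.trans hb.symm)
        rfl
  choose ψ hψ1 hψ2 hψ3 using key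
  have hη : ψ (genericPoint C) = N := by
    have := hψ2 (genericPoint C)
    rwa [TopCat.Presheaf.stalkSpecializes_refl, Spec.map_id, Category.id_comp] at this
  obtain ⟨φ, hφ1, hφ2⟩ := exists_hom_of_fromSpecStalk t (P1.toSpec k) ψ hψ1
    (fun x => (hψ2 x).trans hη.symm)
  exact ⟨φ, hφ1, (hφ2 _).trans hη, fun x b hb => (hφ2 x).trans (hψ3 x b hb)⟩

variable {R : Type u} [CommRing R]

/-- The coordinate ring homomorphism of `P1.point ρ v i hv` in the chart `X i ≠ 0`. -/
abbrev P1.chartHom (ρ : k →+* R) (v : Fin 2 → R) (i : Fin 2) (hv : IsUnit (v i)) :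
    Away (homogeneousSubmodule (Fin 2) k) (X i) →+* R :=
  evalAway _ (eval₂Hom ρ v) (X i) (by rwa [eval₂Hom_X'])

/-- An element of the chart `X i ≠ 0` is a fraction `p / X i ^ n`, and `P1.chartHom` evaluates
it. -/
lemma P1.exists_chartHom_mul_eq (ρ : k →+* R) (v : Fin 2 → R) (i : Fin 2) (hv : IsUnit (v i))
    (z : Away (homogeneousSubmodule (Fin 2) k) (X i)) :
    ∃ (n : ℕ) (p : MvPolynomial (Fin 2) k), p.IsHomogeneous n ∧ (p = 0 → z = 0) ∧
      P1.chartHom ρ v i hv z * v i ^ n = eval₂Hom ρ v p := by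
  obtain ⟨n, p, hp, rfl⟩ := Away.mk_surjective _ (X_mem_homogeneousSubmodule (k := k) i) z
  refine ⟨n, p, by simpa using (mem_homogeneousSubmodule _ _).mp hp, ?_, ?_⟩
  · rintro rfl
    ext
    rw [Away.val_mk, Localization.mk_zero, val_zero]
  · have := evalAway_mk_mul (eval₂Hom ρ v) (by rwa [eval₂Hom_X'])
      (X_mem_homogeneousSubmodule (k := k) i) n p hp
    rwa [congrArg (· ^ n) (eval₂Hom_X' ρ v i)] at this

lemma P1.chartHom_injective [Nontrivial R] (ρ : k →+* R) (v : Fin 2 → R) (i : Fin 2)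
    (hv : IsUnit (v i))
    (h : ∀ n (p : MvPolynomial (Fin 2) k), p.IsHomogeneous n → eval₂Hom ρ v p = 0 → p = 0) :
    Function.Injective (P1.chartHom ρ v i hv) := by
  rw [injective_iff_map_eq_zero]
  intro z hz
  obtain ⟨n, p, hp, hpz, hz'⟩ := P1.exists_chartHom_mul_eq ρ v i hv z
  rw [hz, zero_mul] at hz'
  exact hpz (h n p hp hz'.symm)

lemma P1.mem_range_awayι (y : P1 k) : ∃ i : Fin 2, y ∈ Set.range
    (Proj.awayι (homogeneousSubmodule (Fin 2) k) (X i) (X_mem_homogeneousSubmodule i) one_pos) := by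
  have hadj : Algebra.adjoin (homogeneousSubmodule (Fin 2) k 0)
      (Set.range (X : Fin 2 → MvPolynomial (Fin 2) k)) = ⊤ := by
    refine top_unique fun p _ => ?_
    induction p using MvPolynomial.induction_on with
    | C a =>
      exact Subalgebra.algebraMap_mem (Algebra.adjoin (homogeneousSubmodule (Fin 2) k 0) _)
        (⟨C a, isHomogeneous_C _ a⟩ : homogeneousSubmodule (Fin 2) k 0)
    | add p q hp hq => exact add_mem (hp trivial) (hq trivial)
    | mul_X p i hp => exact mul_mem (hp trivial) (Algebra.subset_adjoin ⟨i, rfl⟩)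
  have htop := Proj.iSup_basicOpen_eq_top' (homogeneousSubmodule (Fin 2) k) X
    (fun i => ⟨1, X_mem_homogeneousSubmodule i⟩) hadj
  obtain ⟨i, hi⟩ := TopologicalSpace.Opens.mem_iSup.mp (htop.ge (trivial : y ∈ (⊤ : (P1 k).Opens)))
  exact ⟨i, by rwa [← Proj.opensRange_awayι _ _ (X_mem_homogeneousSubmodule i) one_pos] at hi⟩

/-- A morphism to the projective line is dominant if no form vanishes at the image of the generic
point. -/
lemma isDominant_of_fromSpecStalk {φ : C ⟶ P1 k} {ρ : k →+* C.functionField}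
    {v : Fin 2 → C.functionField} {i : Fin 2} {hi : IsUnit (v i)}
    (hφ : C.fromSpecStalk (genericPoint C) ≫ φ = P1.point ρ v i hi)
    (hv : ∀ i, IsUnit (v i))
    (h : ∀ n (p : MvPolynomial (Fin 2) k), p.IsHomogeneous n → eval₂Hom ρ v p = 0 → p = 0) :
    IsDominant φ := by
  constructor
  rw [DenseRange, dense_iff_inter_open]
  rintro W hW ⟨y, hy⟩
  obtain ⟨j, z, rfl⟩ := P1.mem_range_awayι y
  let ι := Proj.awayι (homogeneousSubmodule (Fin 2) k) (X j) (X_mem_homogeneousSubmodule j) one_pos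
  have hdense : DenseRange (PrimeSpectrum.comap (P1.chartHom ρ v j (hv j))) := by
    rw [PrimeSpectrum.denseRange_comap_iff_ker_le_nilRadical,
      (RingHom.injective_iff_ker_eq_bot _).mp (P1.chartHom_injective ρ v j (hv j) h)]
    exact bot_le
  obtain ⟨w, hw⟩ := hdense.exists_mem_open (hW.preimage ι.continuous) ⟨z, hy⟩
  rw [P1.point_eq ρ v i j hi (hv j)] at hφ
  refine ⟨φ (C.fromSpecStalk (genericPoint C) w), ?_, _, rfl⟩
  have := congr($hφ w)
  exact this ▸ hw

end MapsToProjectiveLine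

/-! ### Dominance, degree and ramification -/

section Dehomogenization

open MvPolynomial

/-- Forms in two variables over an infinite field do not vanish at `(1, f)` for `f`
transcendental. -/
lemma eq_zero_of_eval₂Hom_eq_zero {k F : Type*} [Field k] [Infinite k] [Field F] [Algebra k F]
    {f : F} (hf : Transcendental k f) {n : ℕ} {p : MvPolynomial (Fin 2) k}
    (hp : p.IsHomogeneous n) (h : eval₂Hom (algebraMap k F) ![1, f] p = 0) : p = 0 := by
  have h1 : aeval ![1, (Polynomial.X : Polynomial k)] p = 0 := by
    apply transcendental_iff_injective.mp hf
    rw [map_zero, ← h]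
    have : ((Polynomial.aeval f).comp (aeval ![1, (Polynomial.X : Polynomial k)]) :
        MvPolynomial (Fin 2) k →ₐ[k] F) = aeval ![1, f] := by
      ext i
      fin_cases i <;> simp
    exact congr($this p)
  -- Hence `p` vanishes at all points `(1, s)`, and by homogeneity outside `X 0 = 0`.
  have h2 (s : k) : eval ![1, s] p = 0 := by
    have : ((Polynomial.aeval s).comp (aeval ![1, (Polynomial.X : Polynomial k)]) :
        MvPolynomial (Fin 2) k →ₐ[k] k) = aeval ![1, s] := by
      ext i
      fin_cases i <;> simp
    have h3 := congr($this p)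
    rw [AlgHom.comp_apply, h1, map_zero] at h3
    rw [h3]
    rfl
  suffices h : X 0 * p = 0 from (mul_eq_zero.mp h).resolve_left (X_ne_zero 0)
  refine MvPolynomial.funext fun v => ?_
  rw [map_mul, map_zero, eval_X]
  by_cases hv : v 0 = 0
  · rw [hv, zero_mul]
  · have h4 : v = v 0 • ![1, (v 0)⁻¹ * v 1] := by
      ext i
      fin_cases i <;> simp [hv]
    rw [h4, ← eval₂_id, ← coe_eval₂Hom, hp.eval₂Hom_smul, coe_eval₂Hom, eval₂_id, h2, mul_zero,
      mul_zero]

end Dehomogenization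

section Degree

open Polynomial IntermediateField

/-- The degree of a field `F` over the subfield of fractions `p(f) / q(f)` is two if it is at
most two and `f` does not generate `F`. -/
lemma finrank_eq_two_of_card_le {k R F : Type*} [Field k] [CommRing R] [Field F] [Algebra k F]
    [Algebra R F] (hR : IsField R) {f : F} (htr : Transcendental k f)
    (hpoly : ∀ p : k[X], ∃ r : R, algebraMap R F r = aeval f p)
    (hfrac : ∀ r : R, ∃ p q : k[X], algebraMap R F r * aeval f q = aeval f p ∧ aeval f q ≠ 0)
    (hcard : ∀ s : Finset F,
      (∀ p : s → k[X], ∑ i, aeval f (p i) * (i : F) = 0 → p = 0) → s.card ≤ 2)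
    (hne : k⟮f⟯ ≠ ⊤) : Module.finrank R F = 2 := by
  let := hR.toField
  have hrank : Module.rank R F ≤ (2 : ℕ) := by
    refine rank_le fun s hs => hcard s fun p hp => ?_
    choose r hr using fun i => hpoly (p i)
    have h0 := Fintype.linearIndependent_iff.mp hs r (by
      rw [← hp]
      exact Finset.sum_congr rfl fun i _ => by rw [Algebra.smul_def, hr])
    ext1 i
    refine transcendental_iff_injective.mp htr ?_
    rw [← hr, h0, map_zero, Pi.zero_apply, map_zero]
  have : Module.Finite R F :=
    Module.rank_lt_aleph0_iff.mp (hrank.trans_lt Cardinal.natCast_lt_aleph0)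
  have hle : Module.finrank R F ≤ 2 := Module.finrank_le_of_rank_le hrank
  have hpos : 0 < Module.finrank R F := Module.finrank_pos
  have hne1 : Module.finrank R F ≠ 1 := fun h1 => hne (top_unique fun a _ => by
    have hbot := Subalgebra.bot_eq_top_of_finrank_eq_one h1
    obtain ⟨r, rfl⟩ := Algebra.mem_bot.mp (hbot.ge (Algebra.mem_top (x := a)))
    obtain ⟨p, q, hpq, hq⟩ := hfrac r
    have hmem (p : k[X]) : aeval f p ∈ k⟮f⟯ :=
      IntermediateField.algebra_adjoin_le_adjoin k {f} (aeval_mem_adjoin_singleton k f)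
    rw [eq_div_of_mul_eq hq hpq]
    exact div_mem (hmem p) (hmem q))
  omega

end Degree

section MapsToProjectiveLine

attribute [local instance] MvPolynomial.gradedAlgebra

open MvPolynomial HomogeneousLocalization IsLocalRing

variable {k : Type u} [Field k] {C : Scheme.{u}} {φ : C ⟶ P1 k}

/-- The local ring of the projective line at the image of `x`, if the composition of `φ` with
`Spec 𝒪_x → C` is the point with the homogeneous coordinates `v`. -/
lemma exists_chartHom_eq_of_fromSpecStalk {x : C} {ρ : k →+* C.presheaf.stalk x}
    {v : Fin 2 → C.presheaf.stalk x} {i : Fin 2} {hi : IsUnit (v i)}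
    (hφ : C.fromSpecStalk x ≫ φ = P1.point (R := C.presheaf.stalk x) ρ v i hi) :
    ∃ κ : Away (homogeneousSubmodule (Fin 2) k) (X i) →+* (P1 k).presheaf.stalk (φ x),
      (∀ a, (φ.stalkMap x).hom (κ a) = P1.chartHom ρ v i hi a) ∧
      ∀ r, ∃ a b, r * κ b = κ a ∧ IsUnit (κ b) :=
  have : IsLocalHom (φ.stalkMap x).hom := φ.toLRSHom.prop x
  have : IsOpenImmersion (Y := P1 k) (Proj.awayι (homogeneousSubmodule (Fin 2) k) (X i)
    (X_mem_homogeneousSubmodule i) one_pos) := inferInstanceAs (IsOpenImmersion (Proj.awayι ..))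
  exists_comp_eq_of_fromSpecStalk (Y := P1 k) (B := C.presheaf.stalk x)
    (CommRingCat.ofHom (P1.chartHom ρ v i hi))
    (Proj.awayι (homogeneousSubmodule (Fin 2) k) (X i) (X_mem_homogeneousSubmodule i) one_pos)
    (φ.stalkMap x) ((Scheme.SpecMap_stalkMap_fromSpecStalk φ).trans hφ)

/-- If the coordinate of `φ` vanishes to order at least two at `x`, then `φ` is ramified at
`x`. -/
lemma isRamifiedAt_of_fromSpecStalk {x : C} {ρ : k →+* C.presheaf.stalk x}
    {b : C.presheaf.stalk x}
    (hφ : C.fromSpecStalk x ≫ φ = P1.point (R := C.presheaf.stalk x) ρ ![b, 1] 1 isUnit_one)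
    (hb : b ∈ maximalIdeal (C.presheaf.stalk x) ^ 2)
    (hx : ¬ maximalIdeal (C.presheaf.stalk x) ≤ maximalIdeal (C.presheaf.stalk x) ^ 2) :
    IsRamifiedAt φ x := by
  obtain ⟨κ, hκ, hfrac⟩ := exists_chartHom_eq_of_fromSpecStalk hφ
  intro heq
  refine hx (heq.ge.trans (Ideal.map_le_iff_le_comap.mpr fun r hr => ?_))
  obtain ⟨a, d, had, hd⟩ := hfrac r
  have ha : κ a ∈ maximalIdeal ((P1 k).presheaf.stalk (φ x)) := had ▸ Ideal.mul_mem_right _ _ hr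
  have : IsLocalHom (φ.stalkMap x).hom := φ.toLRSHom.prop x
  obtain ⟨n, p, -, -, hp⟩ := P1.exists_chartHom_mul_eq ρ ![b, 1] 1 isUnit_one a
  have hone : (![b, 1] : Fin 2 → C.presheaf.stalk x) 1 = 1 := rfl
  rw [hone, one_pow, mul_one, ← hκ] at hp
  -- Modulo the square of the maximal ideal, the value at `(b, 1)` is the value at `(0, 1)`.
  have hval : eval₂Hom ρ ![b, 1] p - ρ (eval ![0, 1] p) ∈
      maximalIdeal (C.presheaf.stalk x) ^ 2 := by
    rw [← Ideal.Quotient.mk_eq_mk_iff_sub_mem]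
    have h : (Ideal.Quotient.mk (maximalIdeal (C.presheaf.stalk x) ^ 2)).comp
        (eval₂Hom ρ ![b, 1]) =
        (Ideal.Quotient.mk (maximalIdeal (C.presheaf.stalk x) ^ 2)).comp
          (ρ.comp (eval ![0, 1])) := by
      refine MvPolynomial.ringHom_ext (fun c => by simp) fun i => ?_
      fin_cases i
      · simpa [Ideal.Quotient.eq_zero_iff_mem] using hb
      · simp
    exact congr($h p)
  have hmem : (φ.stalkMap x).hom (κ a) ∈ maximalIdeal (C.presheaf.stalk x) :=
    map_nonunit (φ.stalkMap x).hom _ ha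
  have hzero : eval ![0, 1] p = 0 := by
    by_contra h0
    have h1 := sub_mem hmem (Ideal.pow_le_self two_ne_zero (hp ▸ hval))
    rw [sub_sub_cancel] at h1
    exact h1 ((IsUnit.mk0 _ h0).map ρ)
  rw [hzero, map_zero, sub_zero, ← hp, ← had, map_mul] at hval
  exact (Ideal.mul_unit_mem_iff_mem _ (hd.map (φ.stalkMap x).hom)).mp hval

end MapsToProjectiveLine

/-! ### Functions of degree two -/

section MapsToProjectiveLine

attribute [local instance] MvPolynomial.gradedAlgebra

open MvPolynomial HomogeneousLocalization IsLocalRing IntermediateField Polynomial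

section ChartHom

variable {k R : Type u} [Field k] [CommRing R] (ρ : k →+* R) (v : Fin 2 → R) (i : Fin 2)
  (hi : IsUnit (v i))

lemma P1.const_mem_range_chartHom (c : k) : ρ c ∈ (P1.chartHom ρ v i hi).range :=
  ⟨fromZeroRingHom _ _ ⟨MvPolynomial.C c, isHomogeneous_C _ c⟩,
    (evalAway_fromZero (eval₂Hom ρ v) _ _).trans (eval₂Hom_C ρ v c)⟩

lemma P1.coe_mem_range_chartHom (hv : v i = 1) (j : Fin 2) :
    v j ∈ (P1.chartHom ρ v i hi).range := by
  have h := evalAway_mk_mul (eval₂Hom ρ v) (by rwa [eval₂Hom_X'])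
    (X_mem_homogeneousSubmodule (k := k) i) 1 (MvPolynomial.X j)
    (by simpa using isHomogeneous_X k j)
  have hX : eval₂Hom ρ v (MvPolynomial.X i) = 1 := (eval₂Hom_X' ρ v i).trans hv
  rw [congrArg (· ^ 1) hX] at h
  simp only [one_pow, mul_one] at h
  exact ⟨_, h.trans (eval₂Hom_X' ρ v j)⟩

end ChartHom

variable {k : Type u} [Field k] [IsAlgClosed k] {C : Scheme.{u}} [IsIntegral C]
  (t : C ⟶ Spec (.of k))

/-- A map given by a rational function `f` has degree two if the function field is an extension of
degree at most two of `k(f)` and is not equal to `k(f)`. The local ring of the projective line at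
the image of the generic point is identified with `k(f)`. -/
lemma mapDegree_eq_two {f : C.functionField}
    (htr : letI := functionFieldAlgebra t; Transcendental k f)
    (hcard : letI := functionFieldAlgebra t; ∀ s : Finset C.functionField,
      (∀ p : s → k[X], ∑ i, aeval f (p i) * (i : C.functionField) = 0 → p = 0) → s.card ≤ 2)
    (hne : letI := functionFieldAlgebra t; k⟮f⟯ ≠ ⊤) {φ : C ⟶ P1 k}
    (hφ : C.fromSpecStalk (genericPoint C) ≫ φ =
      P1.point (R := C.functionField) (constHom t (genericPoint C)) ![1, f] 0 isUnit_one) :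
    mapDegree φ = 2 := by
  let := functionFieldAlgebra t
  have hinj : Function.Injective (P1.chartHom (R := C.functionField)
      (constHom t (genericPoint C)) ![1, f] 0 isUnit_one) :=
    P1.chartHom_injective _ _ _ _ fun n p hp h => eq_zero_of_eval₂Hom_eq_zero htr hp h
  obtain ⟨κ, hκ, hfrac⟩ := exists_chartHom_eq_of_fromSpecStalk hφ
  have hloc : IsLocalHom (φ.stalkMap (genericPoint C)).hom := φ.toLRSHom.prop (genericPoint C)
  have hval (a) : ∃ p : k[X], (φ.stalkMap (genericPoint C)).hom (κ a) = aeval f p := by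
    obtain ⟨n, p, -, -, hp⟩ := P1.exists_chartHom_mul_eq (R := C.functionField)
      (constHom t (genericPoint C)) ![1, f] 0 isUnit_one a
    refine ⟨MvPolynomial.aeval ![1, Polynomial.X] p, ?_⟩
    have h : ((Polynomial.aeval f).comp (MvPolynomial.aeval ![1, (Polynomial.X : Polynomial k)]) :
        MvPolynomial (Fin 2) k →ₐ[k] C.functionField) = MvPolynomial.aeval ![1, f] := by
      ext i
      fin_cases i <;> simp
    have hone : (![1, f] : Fin 2 → C.functionField) 0 = 1 := rfl
    rw [hone, one_pow, mul_one] at hp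
    rw [hκ]
    exact hp.trans congr($h.symm p)
  let := (φ.stalkMap (genericPoint C)).hom.toAlgebra
  refine finrank_eq_two_of_card_le (f := f) ⟨exists_pair_ne _, mul_comm, fun {r} hr => ?_⟩ htr
    (fun p => ?_) (fun r => ?_) hcard hne
  · -- A nonzero element is `κ a / κ b` with `a ≠ 0`, and `κ a` has a nonzero value in the function
    -- field, so that it is a unit.
    obtain ⟨a, b, hab, hb⟩ := hfrac r
    have ha : IsUnit (κ a) := by
      refine hloc.map_nonunit _ (IsUnit.mk0 _ ?_)
      rw [hκ, Ne, map_eq_zero_iff _ hinj]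
      rintro rfl
      rw [map_zero] at hab
      exact hr (hb.mul_left_eq_zero.mp hab)
    exact isUnit_iff_exists_inv.mp (isUnit_of_mul_isUnit_left (hab ▸ ha))
  · suffices h : aeval f p ∈ (P1.chartHom (R := C.functionField)
        (constHom t (genericPoint C)) ![1, f] 0 isUnit_one).range by
      obtain ⟨a, ha⟩ := h
      exact ⟨κ a, (hκ a).trans ha⟩
    have hf := P1.coe_mem_range_chartHom (R := C.functionField)
      (constHom t (genericPoint C)) ![1, f] 0 isUnit_one rfl
    have hc := P1.const_mem_range_chartHom (R := C.functionField)
      (constHom t (genericPoint C)) ![1, f] 0 isUnit_one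
    rw [Polynomial.aeval_eq_sum_range]
    refine sum_mem fun i _ => ?_
    rw [Algebra.smul_def]
    exact mul_mem (hc _) (pow_mem (hf 1) i)
  · obtain ⟨a, b, hab, hb⟩ := hfrac r
    obtain ⟨p, hp⟩ := hval a
    obtain ⟨q, hq⟩ := hval b
    refine ⟨p, q, ?_, ?_⟩
    · rw [← hp, ← hq, ← hab, map_mul]
      rfl
    · rw [← hq]
      exact (hb.map (φ.stalkMap (genericPoint C)).hom).ne_zero

end MapsToProjectiveLine

/-! ### Curves of positive genus -/

section GeneratorOfFunctionField

open Polynomial IntermediateField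

variable {k F S : Type*} [Field k] [Field F] [Algebra k F] {ord : S → F → ℤ}

lemma IsOrderFamily.transcendental [IsAlgClosed k] (h : IsOrderFamily k ord) {f : F} (hf : f ≠ 0)
    {x : S} (hx : ord x f ≠ 0) : Transcendental k f := by
  intro halg
  obtain ⟨c, rfl⟩ := minpoly.mem_range_of_degree_eq_one k f
    (IsAlgClosed.degree_eq_one_of_irreducible k (minpoly.irreducible halg.isIntegral))
  exact hx (h.map_const x fun hc => hf (by rw [hc, map_zero]))

/-- A function whose only pole is a simple one generates the function field. -/
lemma IsOrderFamily.adjoin_eq_top (h : IsOrderFamily k ord) {f : F} (htr : Transcendental k f)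
    {x : S} (hf : f ∈ h.rrSpace {x}) : k⟮f⟯ = ⊤ := by
  have hinj := transcendental_iff_injective.mp htr
  have hmem (p : k[X]) : aeval f p ∈ k⟮f⟯ :=
    algebra_adjoin_le_adjoin k {f} (aeval_mem_adjoin_singleton k f)
  refine top_unique fun a _ => ?_
  -- The field has degree at most one over `k(f)`, so `1` and `a` are dependent over `k[f]`.
  have hnot : ¬ ∀ p : Fin 2 → k[X], ∑ i, aeval f (p i) * ![1, a] i = 0 → p = 0 := fun hp => by
    simpa using h.card_le_of_polynomial_independent hf ![1, a] hp
  push Not at hnot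
  obtain ⟨p, hp, hp0⟩ := hnot
  rw [Fin.sum_univ_two] at hp
  simp only [Matrix.cons_val_zero, Matrix.cons_val_one, mul_one] at hp
  have h1 : aeval f (p 1) ≠ 0 := by
    intro h1
    rw [h1, zero_mul, add_zero] at hp
    refine hp0 (funext fun i => hinj ?_)
    fin_cases i
    · simpa using hp
    · simpa using h1
  rw [eq_div_of_mul_eq h1 ((mul_comm _ _).trans (eq_neg_of_add_eq_zero_right hp))]
  exact div_mem (neg_mem (hmem _)) (hmem _)

end GeneratorOfFunctionField

section Curve

open IsLocalRing IntermediateField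

variable {k : Type u} [Field k] {C : Scheme.{u}} [IsIntegral C]

/-- If the generic point is closed, then `C` is a single point, of codimension zero, and all orders
are zero. -/
lemma not_isClosed_genericPoint [IsLocallyNoetherian C] {f : C.functionField} {x : C}
    (h : C.ord f x ≠ 0) : ¬ IsClosed {genericPoint C} := by
  intro hc
  have hall (y : C) : y = genericPoint C := by
    have := specializes_iff_mem_closure.mp (genericPoint_specializes y)
    rwa [hc.closure_eq, Set.mem_singleton_iff] at this
  refine h (Scheme.ord_eq_zero_of_coheight_neq_one ?_ _)
  have h0 : Order.coheight x = 0 := Order.coheight_eq_zero.mpr fun y _ => by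
    rw [hall x, hall y]
  rw [h0]
  exact zero_ne_one

lemma mem_maximalIdeal_sq_of_two_le_ord [IsLocallyNoetherian C] {x : C}
    [IsDiscreteValuationRing (C.presheaf.stalk x)] (hx : Order.coheight x = 1)
    {b : C.presheaf.stalk x} (hb : b ≠ 0) (h : 2 ≤ C.ord (algebraMap _ C.functionField b) x) :
    b ∈ maximalIdeal (C.presheaf.stalk x) ^ 2 := by
  have hbm := (ord_pos_iff hx hb).mp (by omega)
  obtain ⟨ϖ, hϖ⟩ := IsDiscreteValuationRing.exists_irreducible (C.presheaf.stalk x)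
  have hm := hϖ.maximalIdeal_eq
  rw [hm] at hbm
  obtain ⟨c, rfl⟩ := Ideal.mem_span_singleton.mp hbm
  have hc : c ≠ 0 := right_ne_zero_of_mul hb
  have hinj := IsFractionRing.injective (C.presheaf.stalk x) C.functionField
  have hϖF : algebraMap _ C.functionField ϖ ≠ 0 := (map_ne_zero_iff _ hinj).mpr hϖ.ne_zero
  have hϖ1 : C.ord (algebraMap _ C.functionField ϖ) x = 1 := by
    rw [Scheme.ord_eq_iff hx hϖF, Scheme.ordHom, Ring.ordFrac_irreducible hϖ]
    rfl
  rw [map_mul, Scheme.ord_mul hϖF ((map_ne_zero_iff _ hinj).mpr hc), hϖ1] at h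
  rw [sq]
  exact Ideal.mul_mem_mul (hm ▸ Ideal.mem_span_singleton_self ϖ)
    ((ord_pos_iff hx hc).mp (by omega))

variable [IsAlgClosed k] (t : C ⟶ Spec (.of k)) [IsProper t] [SmoothOfRelativeDimension 1 t]
  [IsLocallyNoetherian C]

lemma adjoin_ne_top_of_genus_ne_zero [CompactSpace C] (hg : genus t ≠ 0) {f : C.functionField}
    (htr : letI := functionFieldAlgebra t; Transcendental k f) :
    letI := functionFieldAlgebra t; k⟮f⟯ ≠ ⊤ := by
  let := functionFieldAlgebra t
  intro hf
  refine hg ?_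
  rw [genus, regularDifferentials_eq_bot t (mem_range_or_inv_mem_range t)
    (fun a ha => exists_algebraMap_eq t ha) htr hf]
  exact finrank_bot _ _

variable [CompactSpace C] {S : Type*} {pt : S → C} (hinj : Function.Injective pt)
  (hcl : ∀ p, IsClosed {pt p}) (hsurj : ∀ x : C, IsClosed {x} → ∃ p, pt p = x)

include hinj hcl hsurj

/-- On a curve of positive genus, the divisor of a function is not of the form `p - q` with
`p ≠ q`. -/
lemma genus_eq_zero_of_ord_eq {f : C.functionField} (hf : f ≠ 0) {p q : S} (hpq : p ≠ q)
    (hord : ∀ x, C.ord f (pt x) = (Finsupp.single q 1 - Finsupp.single p 1 : S →₀ ℤ) x) :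
    genus t = 0 := by
  classical
  by_contra hg
  let := functionFieldAlgebra t
  have hp : C.ord f (pt p) = -1 := by simp [hord, hpq.symm]
  have h := isOrderFamily t (not_isClosed_genericPoint (x := pt p) (f := f) (by omega)) hinj hcl
    hsurj
  have htr := h.transcendental hf (x := p) (by omega)
  refine adjoin_ne_top_of_genus_ne_zero t hg htr (h.adjoin_eq_top htr (x := p) fun _ x => ?_)
  change _ ≤ C.ord f (pt x)
  rw [hord, Finsupp.sub_apply]
  rcases eq_or_ne x p with rfl | hxp
  · simp [hpq.symm]
  · rw [Multiset.count_singleton, if_neg hxp, Finsupp.single_apply (a := p), if_neg hxp.symm,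
      Finsupp.single_apply]
    split_ifs <;> norm_num

/-- On a curve of positive genus, a function with no poles outside `p` and a pole of order two at
`p` defines a map of degree two to the projective line, ramified at `p`. -/
lemma exists_isDegreeTwoMap_isRamifiedAt (hg : genus t ≠ 0) {f : C.functionField} (hf : f ≠ 0)
    {p : S} (hp : C.ord f (pt p) = -2) (hord : ∀ x, x ≠ p → 0 ≤ C.ord f (pt x)) :
    ∃ φ : C ⟶ P1 k, IsDegreeTwoMap t φ ∧ IsRamifiedAt φ (pt p) := by
  classical
  let := functionFieldAlgebra t
  have hη := not_isClosed_genericPoint (x := pt p) (f := f) (by omega)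
  have hgen : pt p ≠ genericPoint C := fun h => hη (h ▸ hcl p)
  have h := isOrderFamily t hη hinj hcl hsurj
  have htr := h.transcendental hf (x := p) (by omega)
  have hne := adjoin_ne_top_of_genus_ne_zero t hg htr
  have hmem : f ∈ h.rrSpace {p, p} := fun _ x => by
    by_cases hx : x = p
    · subst hx
      simp [hp]
    · have := hord x hx
      omega
  obtain ⟨φ, hφt, hφη, hφ⟩ := exists_hom_P1 t hf fun x => mem_range_or_inv_mem_range t x f
  have hdom : IsDominant φ := by
    refine isDominant_of_fromSpecStalk hφη (fun i => ?_)
      fun n q hq h0 => eq_zero_of_eval₂Hom_eq_zero htr hq h0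
    fin_cases i
    · exact isUnit_one
    · exact IsUnit.mk0 f hf
  have hdeg : mapDegree φ = 2 := mapDegree_eq_two t htr (fun s hs => by
    simpa using h.card_le_of_polynomial_independent hmem (fun i : s => (i : C.functionField)) hs)
    hne hφη
  refine ⟨φ, ⟨hφt, hdom, hdeg⟩, ?_⟩
  have hco := coheight_eq_one t (hcl p) hgen
  have := isDiscreteValuationRing_stalk t (hcl p) hgen
  -- The coordinate `X 0 / X 1` of `φ` is `f⁻¹`, which has a double zero at `p`.
  have hpinv : C.ord f⁻¹ (pt p) = 2 := by rw [ord_inv hf, hp]; rfl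
  obtain ⟨b, hb⟩ := (ord_nonneg_iff hco (inv_ne_zero hf)).mp (by omega)
  have hb0 : b ≠ 0 := by
    rintro rfl
    exact inv_ne_zero hf (hb.symm.trans (map_zero _))
  refine isRamifiedAt_of_fromSpecStalk (hφ (pt p) b hb)
    (mem_maximalIdeal_sq_of_two_le_ord hco hb0 (by rw [hb, hpinv])) fun hle => ?_
  exact IsDiscreteValuationRing.not_a_field (C.presheaf.stalk (pt p))
    (Submodule.eq_bot_of_le_smul_of_le_jacobson_bot _ _ (IsNoetherian.noetherian _)
      (by rwa [smul_eq_mul, ← sq]) (maximalIdeal_le_jacobson _))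

end Curve

/-! ### Divisor classes of points -/

section Points

variable {K L : Type u} [Field K] [Field L] [Algebra K L] {X : Scheme.{u}}
  {s : X ⟶ Spec (.of K)} [IsCurve s]

instance : SmoothOfRelativeDimension 1 (baseChangeHom s L) :=
  (smoothOfRelativeDimension_isStableUnderBaseChange 1).of_isPullback
    (IsPullback.of_hasPullback s (specMap K L)) inferInstance

/-- The Albanese map of a rational divisor is equivariant. -/
lemma smul_albanese {D : Div s L} (hD : D.degree = 1) (hDK : Div.IsRational s L D) (P : Pt s L)
    (g : L ≃ₐ[K] L) : g • albanese D hD P = albanese D hD (g • P) := by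
  refine congrArg QuotientAddGroup.mk (Subtype.ext ?_)
  change g • (Finsupp.single P 1 - D) = _
  rw [smul_sub, hDK g]
  congr 1
  exact Finsupp.comapSMul_single g P 1

lemma albanese_add_eq_iff {D : Div s L} (hD : D.degree = 1) (P Q R : Pt s L) :
    albanese D hD Q + albanese D hD R = 2 • albanese D hD P ↔
      Finsupp.single Q 1 + Finsupp.single R 1 - 2 • Finsupp.single P 1 ∈ principal s L := by
  rw [eq_comm]
  refine QuotientAddGroup.eq.trans ?_
  rw [AddSubgroup.mem_addSubgroupOf]
  refine iff_of_eq (congrArg (· ∈ principal s L) ?_)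
  change -(2 • (Finsupp.single P 1 - D)) + ((Finsupp.single Q 1 - D) + (Finsupp.single R 1 - D)) = _
  rw [smul_sub]
  abel

variable [IsAlgClosed L]

lemma Pt.point_injective : Function.Injective (Pt.point : Pt s L → baseChange s L) := by
  intro p q h
  have hpq : p.section = q.section :=
    ext_of_apply_closedPoint_eq (baseChangeHom s L) p.section_snd q.section_snd h
  ext1
  rw [← p.section_fst, ← q.section_fst, hpq]

lemma Pt.isClosed_point (p : Pt s L) : IsClosed {p.point} :=
  (pointEquivClosedPoint (baseChangeHom s L) ⟨p.section, p.section_snd⟩).2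

/-- Every closed point of `X_L` comes from an `L`-valued point of `X`, by the Nullstellensatz. -/
lemma Pt.exists_point_eq {x : baseChange s L} (hx : IsClosed {x}) : ∃ p : Pt s L, p.point = x := by
  obtain ⟨⟨σ, hσ⟩, h⟩ := (pointEquivClosedPoint (baseChangeHom s L)).surjective ⟨x, hx⟩
  let p : Pt s L := ⟨σ ≫ pullback.fst _ _, by
    rw [Category.assoc, pullback.condition, ← Category.assoc]
    change (σ ≫ baseChangeHom s L) ≫ _ = _
    rw [hσ, Category.id_comp]⟩
  have hp : p.section = σ := by
    apply pullback.hom_ext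
    · exact p.section_fst
    · exact p.section_snd.trans hσ.symm
  exact ⟨p, by rw [Pt.point, hp]; exact congrArg Subtype.val h⟩

/-- If the divisor `Q + R - 2 P` is principal on a curve of positive genus and `(X, P)` is not
exceptional, then it is zero. -/
lemma eq_and_eq_of_mem_principal (hg : genus (baseChangeHom s L) ≠ 0) {P Q R : Pt s L}
    (hP : ¬ IsExceptional P)
    (h : Finsupp.single Q 1 + Finsupp.single R 1 - 2 • Finsupp.single P 1 ∈ principal s L) :
    Q = P ∧ R = P := by
  classical
  obtain ⟨f, hf, hord⟩ := h
  have hsimple {R : Pt s L} (h : ∀ p : Pt s L, (baseChange s L).ord f p.point =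
      (Finsupp.single R 1 - Finsupp.single P 1 : Div s L) p) : R = P := by
    by_contra hne
    exact hg (genus_eq_zero_of_ord_eq (baseChangeHom s L) Pt.point_injective Pt.isClosed_point
      (fun _ => Pt.exists_point_eq) hf (Ne.symm hne) h)
  by_cases hQ : Q = P
  · subst hQ
    refine ⟨rfl, hsimple fun p => ?_⟩
    rw [← hord]
    congr 1
    abel
  by_cases hR : R = P
  · subst hR
    refine ⟨hsimple fun p => ?_, rfl⟩
    rw [← hord]
    congr 1
    abel
  obtain ⟨φ, hφ, hram⟩ := exists_isDegreeTwoMap_isRamifiedAt (baseChangeHom s L)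
    Pt.point_injective Pt.isClosed_point (fun _ => Pt.exists_point_eq) hg hf (p := P)
    (by rw [← hord]; simp [hQ, hR]) (fun x hx => by
      rw [← hord]
      simp only [Finsupp.sub_apply, Finsupp.add_apply, Finsupp.smul_apply]
      rw [Finsupp.single_apply (a := P), if_neg hx.symm, Finsupp.single_apply,
        Finsupp.single_apply]
      split_ifs <;> norm_num)
  exact absurd ⟨⟨φ, hφ⟩, ⟨φ, hφ, hram⟩⟩ hP

end Points

end AlgCurve

end


theorem lemma2p1 {K L : Type u} [Field K] [Field L] [Algebra K L] [IsAlgClosure K L]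
    {X : Scheme.{u}} (s : X ⟶ Spec (.of K)) [AlgCurve.IsCurve s]
    (hgenus : 2 ≤ AlgCurve.genus (AlgCurve.baseChangeHom s L))
    (D : AlgCurve.Div s L) (hD : D.degree = 1) (hDK : AlgCurve.Div.IsRational s L D)
    (P : AlgCurve.Pt s L) :
    ((AlgCurve.IsHyperelliptic s L → ¬ AlgCurve.IsHyperellipticBranchPoint P) →
      ∀ g h : L ≃ₐ[K] L,
        g • AlgCurve.albanese D hD P + h • AlgCurve.albanese D hD P =
          2 • AlgCurve.albanese D hD P →
        g • P = P ∧ h • P = P) ∧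
    (AlgCurve.IsExceptional P ∨
      AlgCurve.IsAlmostFixed (L ≃ₐ[K] L) (AlgCurve.albanese D hD P)) := by
  have : IsAlgClosed L := IsAlgClosure.isAlgClosed K
  have key (hP : ¬ AlgCurve.IsExceptional P) (g h : L ≃ₐ[K] L)
      (heq : g • AlgCurve.albanese D hD P + h • AlgCurve.albanese D hD P =
        2 • AlgCurve.albanese D hD P) : g • P = P ∧ h • P = P := by
    rw [AlgCurve.smul_albanese hD hDK, AlgCurve.smul_albanese hD hDK,
      AlgCurve.albanese_add_eq_iff] at heq
    exact AlgCurve.eq_and_eq_of_mem_principal (by omega) hP heq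
  refine ⟨fun hP => key fun hexc => hP hexc.1 hexc.2, ?_⟩
  refine or_iff_not_imp_left.mpr fun hP g h heq => ?_
  obtain ⟨hg, hh⟩ := key hP g h (sub_eq_zero.mp heq)
  rw [AlgCurve.smul_albanese hD hDK, AlgCurve.smul_albanese hD hDK, hg, hh, sub_self]
  exact ⟨rfl, rfl⟩
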